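/- Let $0\le\alpha<2$, $\beta=1-\alpha$ and $\mu<0$, and put $\kappa_\alpha=\frac{2-\alpha}{2}$, $\nu=\sqrt{-\mu}/\kappa_\alpha$. Let $L^2_\beta(0,1)=L^2((0,1);x^\beta\,dx)$ be the real Hilbert space with inner product $\langle f,g\rangle_\beta=\int_0^1 f g\,x^\beta\,dx$, and consider the differential expression $$\mathcal A u=-(x^\alpha u_x)_x-\beta x^{\alpha-1}u_x-\frac{\mu}{x^{2-\alpha}}u .$$ Let $AC_{\rm loc}(0,1)$ be the space of locally absolutely continuous functions on $(0,1)$ and $$D_{\max}=\{u\in AC_{\rm loc}(0,1) : xu_x\in AC_{\rm loc}(0,1),\ u,\mathcal A u\in L^2_\beta(0,1)\}.$$ Let $D(\mathcal A^2)$ be the set of all $u\in D_{\max}$ with $\mathcal A u\in D_{\max}$ and $(xu_x)_x(1)=u(1)=0$ (values at $1$ are limits from the left) such that, in the case $\sqrt{-\mu}<\kappa_\alpha$, also $$\lim_{x\to0^+}x^{\sqrt{-\mu}}u(x)=\lim_{x\to0^+}x^{\sqrt{-\mu}}\mathcal A u(x)=0$$ (no condition at $0$ is imposed if $\sqrt{-\mu}\ge\kappa_\alpha$).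 For $u\in D(\mathcal A^2)$ define $$\mathcal A^2u=x^{2\alpha}u_{xxxx}+\rho_1x^{2\alpha-1}u_{xxx}+\rho_2x^{2\alpha-2}u_{xx}+\rho_3x^{2\alpha-3}u_x+\frac{\rho_4}{x^{4-2\alpha}}u,$$ where $\rho_1=4\alpha+2\beta$, $\rho_2=(2\alpha+\beta)(2\alpha+\beta-1)+(\alpha+\beta)(\alpha-1)+2\mu$, $\rho_3=[(\alpha+\beta)(\alpha-1)+2\mu](2\alpha+\beta-2)$ and $\rho_4=\mu[(\alpha-2)(2\alpha+\beta-3)+\mu]$. Let $J_\nu(x)=\sum_{m\ge0}\frac{(-1)^m}{m!\,\Gamma(m+\nu+1)}\left(\frac x2\right)^{2m+\nu}$ be the Bessel function of the first kind. Then: 1. $\mathcal A^2u=\mathcal A(\mathcal A u)$ almost everywhere in $(0,1)$ for every $u\in D(\mathcal A^2)$, and $-\mathcal A^2:D(\mathcal A^2)\subset L^2_\beta(0,1)\to L^2_\beta(0,1)$ is a well-defined linear operator with dense domain which is self-adjoint and negative: $\langle-\mathcal A^2u,u\rangle_\beta<0$ for all $0\ne u\in D(\mathcal A^2)$. 2.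 The positive zeros of $J_\nu$ form a strictly increasing sequence $(j_{\nu,k})_{k\ge1}$, and the functions $$\Phi_k(x)=\frac{(2\kappa_\alpha)^{1/2}}{|J_\nu'(j_{\nu,k})|}\,x^{(1-\alpha-\beta)/2}J_\nu\big(j_{\nu,k}x^{\kappa_\alpha}\big),\qquad k\ge1,$$ form an orthonormal basis of $L^2_\beta(0,1)$, belong to $D(\mathcal A^2)$ and satisfy, on $(0,1)$, $$\mathcal A^2\Phi_k=\kappa_\alpha^4\,j_{\nu,k}^4\,\Phi_k,\qquad k\ge1 .$$ -/

import Mathlib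

open Set Filter Topology MeasureTheory

noncomputable section

namespace DegenerateFourthOrder

/-- The weighted Lebesgue measure `x ^ β dx` on the interval `(0, 1)`. -/
def weightedMeasure (β : ℝ) : Measure ℝ :=
  (volume.restrict (Ioo (0 : ℝ) 1)).withDensity (fun x => ENNReal.ofReal (x ^ β))

/-- The real Hilbert space `L²((0, 1); x ^ β dx)`, with inner product `∫ f g x ^ β dx`. -/
abbrev L2w (β : ℝ) : Type := Lp ℝ 2 (weightedMeasure β)

/-- `u` is locally absolutely continuous in `(0, 1)`. -/
def ACloc (u : ℝ → ℝ) : Prop :=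
  ∀ a b : ℝ, 0 < a → a ≤ b → b < 1 → AbsolutelyContinuousOnInterval u a b

/-- The second order differential expression
`𝒜 u = -(x ^ α u_x)_x - β x ^ (α - 1) u_x - μ / x ^ (2 - α) u`. -/
def opA (α β μ : ℝ) (u : ℝ → ℝ) (x : ℝ) : ℝ :=
  -deriv (fun y => y ^ α * deriv u y) x - β * x ^ (α - 1) * deriv u x - μ / x ^ (2 - α) * u x

/-- The fourth order differential expression `𝒜²` in expanded form. -/
def opASq (α β μ : ℝ) (u : ℝ → ℝ) (x : ℝ) : ℝ :=
  x ^ (2 * α) * iteratedDeriv 4 u x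
    + (4 * α + 2 * β) * x ^ (2 * α - 1) * iteratedDeriv 3 u x
    + ((2 * α + β) * (2 * α + β - 1) + (α + β) * (α - 1) + 2 * μ)
        * x ^ (2 * α - 2) * iteratedDeriv 2 u x
    + (((α + β) * (α - 1) + 2 * μ) * (2 * α + β - 2)) * x ^ (2 * α - 3) * deriv u x
    + (μ * ((α - 2) * (2 * α + β - 3) + μ)) / x ^ (4 - 2 * α) * u x

/-- The maximal domain of `𝒜` in the case `α + β = 1`, in which `p x = x`: the functions with
`u, p u' ∈ AC_loc(0, 1)` and `u, 𝒜 u ∈ L²((0, 1); x ^ β dx)`. Only the values on `(0, 1)` matter.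
If `u` and `x * deriv u x` are in `AC_loc(0, 1)` then `u` is continuously differentiable there and
`deriv u` is absolutely continuous, so `opA` takes a junk value at most on a null set. -/
def Dmax (α β μ : ℝ) : Set (ℝ → ℝ) :=
  {u | ACloc u ∧ ACloc (fun x => x * deriv u x) ∧
    MemLp u 2 (weightedMeasure β) ∧ MemLp (opA α β μ u) 2 (weightedMeasure β)}

/-- `κ_α = (2 - α) / 2`. -/
def kappa (α : ℝ) : ℝ := (2 - α) / 2

/-- `μ(δ) = (1 - δ)² / 4`. -/
def muCrit (δ : ℝ) : ℝ := (1 - δ) ^ 2 / 4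

/-- `ν(α, β, μ) = √(μ(α + β) - μ) / κ_α`. -/
def nu (α β μ : ℝ) : ℝ := √(muCrit (α + β) - μ) / kappa α

/-- The domain of `𝒜²` in the case `α + β = 1`. Values at the endpoint `1` are limits from the
left; the two conditions at `0` are imposed only if `√(-μ) < κ_α`. -/
def domASq (α β μ : ℝ) : Set (ℝ → ℝ) :=
  {u | u ∈ Dmax α β μ ∧ opA α β μ u ∈ Dmax α β μ ∧
    (√(-μ) < kappa α →
      Tendsto (fun x => x ^ √(-μ) * u x) (𝓝[>] 0) (𝓝 0) ∧
      Tendsto (fun x => x ^ √(-μ) * opA α β μ u x) (𝓝[>] 0) (𝓝 0)) ∧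
    Tendsto (deriv (fun x => x * deriv u x)) (𝓝[<] 1) (𝓝 0) ∧
    Tendsto u (𝓝[<] 1) (𝓝 0)}

/-- The Bessel function `J_ν` of the first kind (meant for `x ≥ 0`). -/
def besselJ (ν x : ℝ) : ℝ :=
  ∑' m : ℕ, (-1) ^ m / ((m.factorial : ℝ) * Real.Gamma (m + ν + 1)) * (x / 2) ^ (2 * (m : ℝ) + ν)

/-- For `k ≥ 1`, the `k`-th positive zero `j_{ν,k}` of `J_ν`; the value at `k = 0` is `0`. -/
def besselZero (ν : ℝ) : ℕ → ℝ
  | 0 => 0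
  | k + 1 => sInf {x | besselZero ν k < x ∧ besselJ ν x = 0}

/-- `Φ_k(x) = (2 κ_α) ^ (1/2) / |J_ν'(j_{ν,k})| x ^ ((1 - α - β)/2) J_ν(j_{ν,k} x ^ κ_α)`, `k ≥ 1`,
with `ν = ν(α, β, μ)`. -/
def Phi (α β μ : ℝ) (k : ℕ) (x : ℝ) : ℝ :=
  √(2 * kappa α) / |deriv (besselJ (nu α β μ)) (besselZero (nu α β μ) k)|
    * x ^ ((1 - α - β) / 2) * besselJ (nu α β μ) (besselZero (nu α β μ) k * x ^ kappa α)

/-- `T` is the operator `-𝒜² : D(𝒜²) ⊂ L²_β → L²_β`: its domain consists of the classes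
of the functions in `domASq`, and it maps the class of `u` to the class of `-𝒜² u`.
At most one `T` has this property. -/
def IsNegASq (α β μ : ℝ) (T : L2w β →ₗ.[ℝ] L2w β) : Prop :=
  (∀ f : L2w β, f ∈ T.domain ↔ ∃ u ∈ domASq α β μ, f =ᵐ[weightedMeasure β] u) ∧
  ∀ f : T.domain, ∀ u ∈ domASq α β μ, (f : L2w β) =ᵐ[weightedMeasure β] u →
    T f =ᵐ[weightedMeasure β] fun x => -opASq α β μ u x

end DegenerateFourthOrder

end

noncomputable section

namespace DegenerateFourthOrder

/-! ### The weighted measure -/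

/-! Write `μ = -s ^ 2` with `s > 0`. Since `α + β = 1`, the expression is `𝒜 u = -x ^ (-β) ((x u')'
- s ^ 2 u / x)`, with homogeneous solutions `x ^ s` and `x ^ (-s)`. The plan is to invert `𝒜`
explicitly and to read everything off the inverse.

Variation of constants gives the solution `green s β f` of `𝒜 u = f` that vanishes at `1` and at
`0`. Integration by parts (`integral_green_mul`) shows that it defines an operator `G = H* H`, where
`H` is a weighted Hardy operator with bounded, hence square integrable, kernel. So `G` is symmetric,
positive, injective and compact. The endpoint conditions are those that remove `x ^ (-s)` from the
general solution (`eq_green_opA`): for `s < (1 + β) / 2 = κ_α` a condition at `0` is needed,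
otherwise `x ^ (-s)` is not in `L²_β`. Given `u(1) = 0`, the condition `(x u_x)_x(1) = 0` amounts to
`𝒜 u(1) = 0`. Hence `D(𝒜²)` is the range of `G²` and `-𝒜²` is the inverse of `-G²`; the inverse of
an injective bounded symmetric operator is densely defined and self-adjoint, and `⟨-𝒜² u, u⟩ = -‖𝒜
u‖²`.

For the basis, the spectral theorem says that the eigenvectors of `G` span a dense subspace. An
eigenvector is a classical solution of `𝒜 u = q u` vanishing at `0` and `1`. Its Wronskian with
`J_ν(c x ^ κ)`, `q = κ² c²`, is zero, which gives `J_ν(c) = 0`; and a solution with zero Cauchy data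
at `1` is zero, so `u` is a multiple of `J_ν(c x ^ κ)`. A Pohozaev identity
(`IsBesselPair.integral_sq`) supplies this uniqueness, the simplicity of the zeros and the
normalizing constants. Completeness also yields infinitely many zeros: otherwise `L²` would be
finite dimensional and `G` onto, although its values tend to `0` at the origin. -/

theorem measurable_ofReal_rpow (β : ℝ) : Measurable fun x : ℝ => ENNReal.ofReal (x ^ β) := by
  fun_prop

theorem weightedMeasure_absolutelyContinuous (β : ℝ) :
    weightedMeasure β ≪ volume.restrict (Ioo (0 : ℝ) 1) :=
  withDensity_absolutelyContinuous _ _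

/-- The density is positive on `(0, 1)`, so the two measures have the same null sets. -/
theorem ae_weightedMeasure_iff {β : ℝ} {p : ℝ → Prop} :
    (∀ᵐ x ∂weightedMeasure β, p x) ↔ ∀ᵐ x ∂volume.restrict (Ioo (0 : ℝ) 1), p x := by
  rw [weightedMeasure, ae_withDensity_iff (measurable_ofReal_rpow β)]
  constructor <;> intro h
  · filter_upwards [h, ae_restrict_mem measurableSet_Ioo] with x hx h1
    exact hx (by simpa using Real.rpow_pos_of_pos h1.1 β)
  · filter_upwards [h] with x hx _ using hx

theorem ae_weightedMeasure_of_forall {β : ℝ} {p : ℝ → Prop} (h : ∀ x ∈ Ioo (0 : ℝ) 1, p x) :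
    ∀ᵐ x ∂weightedMeasure β, p x :=
  ae_weightedMeasure_iff.2 ((ae_restrict_mem measurableSet_Ioo).mono h)

theorem integral_weightedMeasure (β : ℝ) (g : ℝ → ℝ) :
    ∫ x, g x ∂weightedMeasure β = ∫ x in (0 : ℝ)..1, x ^ β * g x := by
  rw [weightedMeasure, integral_withDensity_eq_integral_toReal_smul (measurable_ofReal_rpow β)
    (by simp), intervalIntegral.integral_of_le zero_le_one, integral_Ioc_eq_integral_Ioo]
  refine setIntegral_congr_fun measurableSet_Ioo fun x hx => ?_
  simp [ENNReal.toReal_ofReal (Real.rpow_nonneg hx.1.le β)]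

theorem integrable_weightedMeasure_iff {β : ℝ} {g : ℝ → ℝ} :
    Integrable g (weightedMeasure β) ↔
      IntervalIntegrable (fun x => x ^ β * g x) volume 0 1 := by
  rw [weightedMeasure, integrable_withDensity_iff_integrable_smul' (measurable_ofReal_rpow β)
    (by simp), intervalIntegrable_iff_integrableOn_Ioo_of_le zero_le_one, IntegrableOn]
  refine integrable_congr ?_
  filter_upwards [ae_restrict_mem measurableSet_Ioo] with x hx
  simp [ENNReal.toReal_ofReal (Real.rpow_nonneg hx.1.le β)]

theorem aestronglyMeasurable_weightedMeasure {β : ℝ} {E : Type*} [TopologicalSpace E]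
    [TopologicalSpace.PseudoMetrizableSpace E]  {g : ℝ → E}
    (hg : ContinuousOn g (Ioo (0 : ℝ) 1)) : AEStronglyMeasurable g (weightedMeasure β) :=
  (hg.aestronglyMeasurable measurableSet_Ioo).mono_ac (weightedMeasure_absolutelyContinuous β)

theorem memLp_two_weightedMeasure_iff {β : ℝ} {g : ℝ → ℝ}
    (hg : AEStronglyMeasurable g (weightedMeasure β)) :
    MemLp g 2 (weightedMeasure β) ↔
      IntervalIntegrable (fun x => x ^ β * g x ^ 2) volume 0 1 := by
  rw [memLp_two_iff_integrable_sq hg, integrable_weightedMeasure_iff]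

theorem memLp_rpow_iff {β r : ℝ} :
    MemLp (fun x : ℝ => x ^ r) 2 (weightedMeasure β) ↔ -1 < β + 2 * r := by
  have hm : AEStronglyMeasurable (fun x : ℝ => x ^ r) (weightedMeasure β) := by
    have : Measurable fun x : ℝ => x ^ r := by fun_prop
    exact this.aestronglyMeasurable
  rw [memLp_two_weightedMeasure_iff hm, intervalIntegrable_iff_integrableOn_Ioo_of_le zero_le_one,
    ← intervalIntegral.integrableOn_Ioo_rpow_iff (zero_lt_one' ℝ)]
  refine integrableOn_congr_fun (fun x hx => ?_) measurableSet_Ioo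
  have hx0 : (0 : ℝ) < x := hx.1
  rw [Real.rpow_add hx0, mul_comm 2 r, Real.rpow_mul hx0.le]
  norm_num

theorem isFiniteMeasure_weightedMeasure {β : ℝ} (hβ : -1 < β) :
    IsFiniteMeasure (weightedMeasure β) := by
  have h : Integrable (fun _ : ℝ => (1 : ℝ)) (weightedMeasure β) := by
    rw [integrable_weightedMeasure_iff]
    simpa using intervalIntegral.intervalIntegrable_rpow' (a := 0) (b := 1) hβ
  exact (integrable_const_iff_isFiniteMeasure (one_ne_zero' ℝ)).1 h

theorem memLp_of_continuousOn_of_bound {β : ℝ} (hβ : -1 < β) {g : ℝ → ℝ} {C : ℝ}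
    (hg : ContinuousOn g (Ioo (0 : ℝ) 1)) (hC : ∀ x ∈ Ioo (0 : ℝ) 1, |g x| ≤ C) :
    MemLp g 2 (weightedMeasure β) :=
  have := isFiniteMeasure_weightedMeasure hβ
  MemLp.of_bound (aestronglyMeasurable_weightedMeasure hg) C (ae_weightedMeasure_of_forall hC)

/-- The inner product of `L²_β` in terms of representatives. -/
theorem inner_eq_of_ae {β : ℝ} {f g : L2w β} {u v : ℝ → ℝ} (hu : f =ᵐ[weightedMeasure β] u)
    (hv : g =ᵐ[weightedMeasure β] v) :
    inner ℝ f g = ∫ x in (0 : ℝ)..1, x ^ β * (u x * v x) := by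
  rw [L2.inner_def, ← integral_weightedMeasure]
  refine integral_congr_ae ?_
  filter_upwards [hu, hv] with x h1 h2
  simp [h1, h2, mul_comm]

theorem integrable_mul_of_memLp {β : ℝ} {u v : ℝ → ℝ} (hu : MemLp u 2 (weightedMeasure β))
    (hv : MemLp v 2 (weightedMeasure β)) :
    IntervalIntegrable (fun x => x ^ β * (u x * v x)) volume 0 1 :=
  integrable_weightedMeasure_iff.1 (hu.integrable_mul hv)

/-! ### Hilbert–Schmidt integral operators -/

section HilbertSchmidt

variable {Z H : Type*} [MeasurableSpace Z] {ρ : Measure Z} [NormedAddCommGroup H]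
  [InnerProductSpace ℝ H]

/-- The operator `f ↦ (z ↦ ⟪h z, f⟫)` associated with a square integrable `h`. -/
def innerOp (h : Z → H) (hh : MemLp h 2 ρ) : H →L[ℝ] Lp ℝ 2 ρ :=
  LinearMap.mkContinuous
    { toFun := fun f => (hh.inner_const (𝕜 := ℝ) f).toLp _
      map_add' := fun f g => by
        rw [← MemLp.toLp_add]
        exact MemLp.toLp_congr _ _ (Eventually.of_forall fun z => inner_add_right _ _ _)
      map_smul' := fun c f => by
        rw [RingHom.id_apply, ← MemLp.toLp_const_smul]
        exact MemLp.toLp_congr _ _ (Eventually.of_forall fun z => by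
          simp [inner_smul_right]) }
    ‖hh.toLp h‖ fun f => by
      rw [mul_comm]
      refine Lp.norm_le_mul_norm_of_ae_le_mul ?_
      filter_upwards [(hh.inner_const (𝕜 := ℝ) f).coeFn_toLp, hh.coeFn_toLp] with z h1 h2
      simp only [LinearMap.coe_mk, AddHom.coe_mk]
      rw [h1, h2, mul_comm]
      exact norm_inner_le_norm _ _

theorem innerOp_apply {h : Z → H} (hh : MemLp h 2 ρ) (f : H) :
    innerOp h hh f = (hh.inner_const (𝕜 := ℝ) f).toLp _ :=
  rfl

theorem innerOp_coeFn {h : Z → H} (hh : MemLp h 2 ρ) (f : H) :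
    innerOp h hh f =ᵐ[ρ] fun z => inner ℝ (h z) f :=
  (hh.inner_const (𝕜 := ℝ) f).coeFn_toLp

theorem norm_innerOp_le {h : Z → H} (hh : MemLp h 2 ρ) : ‖innerOp h hh‖ ≤ ‖hh.toLp h‖ :=
  LinearMap.mkContinuous_norm_le _ (norm_nonneg _) _

theorem innerOp_congr {h k : Z → H} (hh : MemLp h 2 ρ) (hk : MemLp k 2 ρ) (hhk : h =ᵐ[ρ] k) :
    innerOp h hh = innerOp k hk := by
  ext1 f
  rw [innerOp_apply, innerOp_apply]
  exact MemLp.toLp_congr _ _ (hhk.mono fun z hz => by simp [hz])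

theorem innerOp_add {h k : Z → H} (hh : MemLp h 2 ρ) (hk : MemLp k 2 ρ) :
    innerOp (h + k) (hh.add hk) = innerOp h hh + innerOp k hk := by
  ext1 f
  rw [add_apply, innerOp_apply, innerOp_apply, innerOp_apply, ← MemLp.toLp_add]
  exact MemLp.toLp_congr _ _ (Eventually.of_forall fun z => inner_add_left _ _ _)

theorem innerOp_sub {h k : Z → H} (hh : MemLp h 2 ρ) (hk : MemLp k 2 ρ) :
    innerOp (h - k) (hh.sub hk) = innerOp h hh - innerOp k hk := by
  ext1 f
  rw [sub_apply, innerOp_apply, innerOp_apply, innerOp_apply, ← MemLp.toLp_sub]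
  exact MemLp.toLp_congr _ _ (Eventually.of_forall fun z => inner_sub_left _ _ _)

/-- The operator norm is at most the `L²` norm of the kernel, so the linear map is 1-Lipschitz. This
lets compactness pass to limits of kernels. -/
theorem continuous_innerOp :
    Continuous fun h : Lp H 2 ρ => innerOp (h : Z → H) (Lp.memLp h) := by
  refine LipschitzWith.continuous (K := 1) (LipschitzWith.of_dist_le_mul fun h k => ?_)
  rw [dist_eq_norm, dist_eq_norm, ← innerOp_sub (Lp.memLp h) (Lp.memLp k)]
  refine (norm_innerOp_le _).trans ?_
  rw [MemLp.toLp_sub (Lp.memLp h) (Lp.memLp k), Lp.toLp_coeFn, Lp.toLp_coeFn]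
  simp

/-- Operators associated with square integrable kernels are compact. -/
theorem isCompactOperator_innerOp {h : Z → H} (hh : MemLp h 2 ρ) :
    IsCompactOperator (innerOp h hh) := by
  -- Induction on the kernel: a vector times an indicator gives rank one, sums preserve compactness,
  -- and the compact operators are closed in operator norm.
  refine MemLp.induction (p := 2) (by simp)
    (fun h => ∀ hh : MemLp h 2 ρ, IsCompactOperator (innerOp h hh)) ?_ ?_ ?_ ?_ hh hh
  · intro c s hs hμ hh
    have h1 : MemLp (s.indicator fun _ => (1 : ℝ)) 2 ρ := memLp_indicator_const 2 hs 1 (Or.inr hμ.ne)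
    let R : H →L[ℝ] Lp ℝ 2 ρ :=
      (ContinuousLinearMap.toSpanSingleton ℝ (h1.toLp _)).comp (innerSL ℝ c)
    have hR : IsCompactOperator R :=
      IsCompactOperator.comp_clm (isCompactOperator_of_locallyCompactSpace_rng
        (ContinuousLinearMap.toSpanSingleton ℝ (h1.toLp _))) (innerSL ℝ c)
    have : innerOp _ hh = R := by
      ext1 f
      change _ = inner ℝ c f • h1.toLp _
      rw [innerOp_apply, ← MemLp.toLp_const_smul]
      refine MemLp.toLp_congr _ _ (Eventually.of_forall fun z => ?_)
      by_cases hz : z ∈ s <;> simp [hz]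
    rw [this]
    exact hR
  · intro f g _ hf hg h1 h2 hh
    rw [innerOp_add hf hg]
    exact (h1 hf).add (h2 hg)
  · have : {f : Lp H 2 ρ | ∀ hh : MemLp (f : Z → H) 2 ρ, IsCompactOperator (innerOp (f : Z → H) hh)}
        = (fun h : Lp H 2 ρ => innerOp (h : Z → H) (Lp.memLp h)) ⁻¹'
          {T | IsCompactOperator T} := by
      ext f
      exact ⟨fun h => h _, fun h _ => h⟩
    rw [this]
    exact isClosed_setOfPred_isCompactOperator.preimage continuous_innerOp
  · intro f g hfg hf h1 hg
    rw [← innerOp_congr hf hg hfg]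
    exact h1 hf

end HilbertSchmidt

/-! ### Inverses of bounded self-adjoint operators -/

section Inverse

variable {H : Type*} [NormedAddCommGroup H] [InnerProductSpace ℝ H]

/-- The inverse of an injective bounded operator, defined on its range. -/
def rangeInverse (S : H →L[ℝ] H) (hS : Function.Injective S) : H →ₗ.[ℝ] H where
  domain := LinearMap.range (S : H →ₗ[ℝ] H)
  toFun := (LinearEquiv.ofInjective (S : H →ₗ[ℝ] H) hS).symm

theorem apply_rangeInverse (S : H →L[ℝ] H) (hS : Function.Injective S)
    (f : (rangeInverse S hS).domain) : S (rangeInverse S hS f) = f :=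
  congrArg Subtype.val ((LinearEquiv.ofInjective (S : H →ₗ[ℝ] H) hS).apply_symm_apply f)

theorem mem_rangeInverse_domain (S : H →L[ℝ] H) (hS : Function.Injective S) {f : H} :
    f ∈ (rangeInverse S hS).domain ↔ ∃ g, S g = f :=
  LinearMap.mem_range

theorem rangeInverse_eq (S : H →L[ℝ] H) (hS : Function.Injective S)
    (f : (rangeInverse S hS).domain) {g : H} (hg : S g = f) : rangeInverse S hS f = g :=
  hS ((apply_rangeInverse S hS f).trans hg.symm)

variable [CompleteSpace H]

/-- If `y` is orthogonal to the range, then `0 = ⟪S (S y), y⟫ = ‖S y‖²`, so `y = 0` by injectivity.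
-/
theorem dense_rangeInverse_domain (S : H →L[ℝ] H) (hS : Function.Injective S)
    (hsym : (S : H →ₗ[ℝ] H).IsSymmetric) : Dense ((rangeInverse S hS).domain : Set H) := by
  rw [Submodule.dense_iff_topologicalClosure_eq_top, Submodule.topologicalClosure_eq_top_iff,
    Submodule.eq_bot_iff]
  intro y hy
  refine hS ?_
  rw [map_zero, ← inner_self_eq_zero (𝕜 := ℝ)]
  have h1 := (Submodule.mem_orthogonal _ _).1 hy (S (S y)) ⟨S y, rfl⟩
  rwa [show inner ℝ (S (S y)) y = inner ℝ (S y) (S y) from hsym (S y) y] at h1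

/-- Symmetry of `S` gives `T ≤ T*` for the inverse `T`. Conversely, for `y` in the domain of `T*`,
testing against `S g` gives `⟪T* y, S g⟫ = ⟪y, g⟫` for all `g`, that is `y = S (T* y)`, which lies
in the range of `S`. -/
theorem isSelfAdjoint_rangeInverse (S : H →L[ℝ] H) (hS : Function.Injective S)
    (hsym : (S : H →ₗ[ℝ] H).IsSymmetric) : IsSelfAdjoint (rangeInverse S hS) := by
  have hd := dense_rangeInverse_domain S hS hsym
  rw [LinearPMap.isSelfAdjoint_def]
  have hform : (rangeInverse S hS).IsFormalAdjoint (rangeInverse S hS) := by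
    intro x y
    rw [← apply_rangeInverse S hS x, ← apply_rangeInverse S hS y]
    exact (hsym _ _).symm
  have hle := hform.le_adjoint hd
  refine (LinearPMap.eq_of_le_of_domain_eq hle (le_antisymm hle.1 fun y hy => ?_)).symm
  refine (mem_rangeInverse_domain S hS).2 ⟨(rangeInverse S hS).adjoint ⟨y, hy⟩, ?_⟩
  refine ext_inner_right ℝ fun g => ?_
  have h1 := LinearPMap.adjoint_isFormalAdjoint hd ⟨y, hy⟩ ⟨S g, ⟨g, rfl⟩⟩
  rw [rangeInverse_eq S hS _ (g := g) rfl] at h1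
  exact (hsym _ _).trans h1

end Inverse

/-! ### Locally absolutely continuous functions on `(0, 1)` -/

theorem ACloc.congr {u v : ℝ → ℝ} (hu : ACloc u) (h : EqOn u v (Ioo 0 1)) : ACloc v := by
  intro a b ha hab hb
  have hI := hu a b ha hab hb
  have hsub : uIcc a b ⊆ Ioo (0 : ℝ) 1 := by
    rw [uIcc_of_le hab]
    exact fun x hx => ⟨ha.trans_le hx.1, hx.2.trans_lt hb⟩
  rw [absolutelyContinuousOnInterval_iff] at hI ⊢
  intro ε hε
  obtain ⟨δ, hδ, H⟩ := hI ε hε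
  refine ⟨δ, hδ, fun E hE hlen => ?_⟩
  convert! H E hE hlen using 1
  refine Finset.sum_congr rfl fun i hi => ?_
  rw [h (hsub (hE.1 i hi).1), h (hsub (hE.1 i hi).2)]

theorem ACloc.add {u v : ℝ → ℝ} (hu : ACloc u) (hv : ACloc v) : ACloc fun x => u x + v x :=
  fun a b ha hab hb => (hu a b ha hab hb).fun_add (hv a b ha hab hb)

theorem ACloc.sub {u v : ℝ → ℝ} (hu : ACloc u) (hv : ACloc v) : ACloc fun x => u x - v x :=
  fun a b ha hab hb => (hu a b ha hab hb).fun_sub (hv a b ha hab hb)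

theorem ACloc.mul {u v : ℝ → ℝ} (hu : ACloc u) (hv : ACloc v) : ACloc fun x => u x * v x :=
  fun a b ha hab hb => (hu a b ha hab hb).fun_mul (hv a b ha hab hb)

theorem ACloc.const_mul {u : ℝ → ℝ} (c : ℝ) (hu : ACloc u) : ACloc fun x => c * u x :=
  fun a b ha hab hb => (hu a b ha hab hb).const_mul c

theorem ACloc.of_contDiffOn {u : ℝ → ℝ} (hu : ContDiffOn ℝ 1 u (Ioo 0 1)) : ACloc u := by
  intro a b ha hab hb
  refine (hu.mono ?_).absolutelyContinuousOnInterval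
  rw [uIcc_of_le hab]
  exact fun x hx => ⟨ha.trans_le hx.1, hx.2.trans_lt hb⟩

theorem ACloc.of_hasDerivAt {u u' : ℝ → ℝ} (hu : ∀ x ∈ Ioo (0 : ℝ) 1, HasDerivAt u (u' x) x)
    (hu' : ContinuousOn u' (Ioo 0 1)) : ACloc u := by
  refine ACloc.of_contDiffOn ?_
  rw [show (1 : WithTop ℕ∞) = 0 + 1 by simp, contDiffOn_succ_iff_deriv_of_isOpen isOpen_Ioo]
  refine ⟨fun x hx => (hu x hx).differentiableAt.differentiableWithinAt, by simp, ?_⟩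
  rw [contDiffOn_zero]
  exact hu'.congr fun x hx => (hu x hx).deriv

theorem ACloc.rpow (r : ℝ) : ACloc fun x => x ^ r :=
  ACloc.of_contDiffOn fun _ hx =>
    (Real.contDiffAt_rpow_const_of_ne hx.1.ne').contDiffWithinAt

theorem ACloc.continuousOn {u : ℝ → ℝ} (hu : ACloc u) : ContinuousOn u (Ioo 0 1) := by
  intro x hx
  have h1 := (hu (x / 2) ((x + 1) / 2) (by linarith [hx.1]) (by linarith [hx.1, hx.2])
    (by linarith [hx.2])).continuousOn
  rw [uIcc_of_le (by linarith [hx.1, hx.2])] at h1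
  exact (h1.continuousAt (Icc_mem_nhds (by linarith [hx.1])
    (by linarith [hx.2]))).continuousWithinAt

/-- A property that holds almost everywhere on compact subintervals of `(0, 1)`
holds almost everywhere. -/
theorem ae_restrict_Ioo_of_forall_Icc {p : ℝ → Prop}
    (h : ∀ a b : ℝ, 0 < a → a ≤ b → b < 1 → ∀ᵐ x, x ∈ Icc a b → p x) :
    ∀ᵐ x ∂volume.restrict (Ioo (0 : ℝ) 1), p x := by
  have hall : ∀ᵐ x : ℝ, ∀ n : ℕ, x ∈ Icc (1 / ((n : ℝ) + 3)) (1 - 1 / ((n : ℝ) + 3)) → p x := by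
    rw [ae_all_iff]
    intro n
    have h3 : (1 : ℝ) / ((n : ℝ) + 3) ≤ 1 / 3 := by
      apply one_div_le_one_div_of_le <;> linarith [n.cast_nonneg (α := ℝ)]
    have h0 : (0 : ℝ) < 1 / ((n : ℝ) + 3) := by positivity
    exact h _ _ h0 (by linarith) (by linarith)
  rw [ae_restrict_iff' measurableSet_Ioo]
  filter_upwards [hall] with x hx h01
  obtain ⟨n, hn⟩ := exists_nat_one_div_lt (lt_min h01.1 (sub_pos.2 h01.2))
  have h2 : (1 : ℝ) / ((n : ℝ) + 3) ≤ 1 / ((n : ℝ) + 1) := by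
    apply one_div_le_one_div_of_le <;> linarith [n.cast_nonneg (α := ℝ)]
  have h3 := h2.trans_lt hn
  exact hx n ⟨(h3.trans_le (min_le_left _ _)).le, by linarith [h3.trans_le (min_le_right x (1 - x))]⟩

theorem ACloc.ae_differentiableAt {u : ℝ → ℝ} (hu : ACloc u) :
    ∀ᵐ x ∂volume.restrict (Ioo (0 : ℝ) 1), DifferentiableAt ℝ u x :=
  ae_restrict_Ioo_of_forall_Icc fun a b ha hab hb => by
    simpa [uIcc_of_le hab] using (hu a b ha hab hb).ae_differentiableAt

theorem ACloc.eq_of_ae_hasDerivAt_zero {u : ℝ → ℝ} (hu : ACloc u)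
    (h : ∀ᵐ x ∂volume.restrict (Ioo (0 : ℝ) 1), HasDerivAt u 0 x) :
    ∃ c, ∀ x ∈ Ioo (0 : ℝ) 1, u x = c := by
  have key : ∀ a b : ℝ, 0 < a → a ≤ b → b < 1 → u a = u b := by
    intro a b ha hab hb
    obtain ⟨C, hC⟩ := (hu a b ha hab hb).const_of_ae_hasDerivAt_zero (by
      rw [ae_restrict_iff' measurableSet_Ioo] at h
      filter_upwards [h] with x hx hx'
      rw [uIcc_of_le hab] at hx'
      exact hx ⟨ha.trans_le hx'.1, hx'.2.trans_lt hb⟩)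
    rw [hC _ left_mem_uIcc, hC _ right_mem_uIcc]
  refine ⟨u (1 / 2), fun x hx => ?_⟩
  rcases le_total x (1 / 2) with h2 | h2
  · exact key _ _ hx.1 h2 (by norm_num)
  · exact (key _ _ (by norm_num) h2 hx.2).symm

/-- An absolutely continuous function is the integral of its almost everywhere derivative; if that
agrees with a continuous `h`, the fundamental theorem gives the derivative at every point. This is
how functions in the maximal domain become classically differentiable. -/
theorem ACloc.hasDerivAt_of_ae {u h : ℝ → ℝ} (hu : ACloc u) (hc : ContinuousOn h (Ioo 0 1))
    (hd : ∀ᵐ x ∂volume.restrict (Ioo (0 : ℝ) 1), HasDerivAt u (h x) x) {x : ℝ}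
    (hx : x ∈ Ioo (0 : ℝ) 1) : HasDerivAt u (h x) x := by
  set a := x / 2 with ha
  have ha0 : 0 < a := by linarith [hx.1]
  have hax : x ∈ Ioo a 1 := ⟨by linarith [hx.1], hx.2⟩
  have h1 : HasDerivAt (fun y => ∫ t in a..y, h t) (h x) x := by
    refine intervalIntegral.integral_hasDerivAt_right ?_ ?_ ?_
    · refine ContinuousOn.intervalIntegrable ?_
      rw [uIcc_of_le hax.1.le]
      exact hc.mono fun z hz => ⟨ha0.trans_le hz.1, hz.2.trans_lt hx.2⟩
    · exact hc.stronglyMeasurableAtFilter isOpen_Ioo x hx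
    · exact hc.continuousAt (isOpen_Ioo.mem_nhds hx)
  have h2 : (fun y => (∫ t in a..y, h t) + u a) =ᶠ[𝓝 x] u := by
    filter_upwards [isOpen_Ioo.mem_nhds hax] with y hy
    have h3 : ∫ t in a..y, h t = ∫ t in a..y, deriv u t := by
      refine intervalIntegral.integral_congr_ae ?_
      rw [ae_restrict_iff' measurableSet_Ioo] at hd
      filter_upwards [hd] with t ht hta
      rw [uIoc_of_le hy.1.le] at hta
      exact (ht ⟨ha0.trans hta.1, hta.2.trans_lt hy.2⟩).deriv.symm
    rw [h3, (hu a y ha0 hy.1.le hy.2).integral_deriv_eq_sub]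
    ring
  exact (h1.add_const (u a)).congr_of_eventuallyEq h2.symm

theorem ACloc.hasDerivAt_deriv {u : ℝ → ℝ} (hu : ACloc u)
    (hc : ContinuousOn (deriv u) (Ioo 0 1)) {x : ℝ} (hx : x ∈ Ioo (0 : ℝ) 1) :
    HasDerivAt u (deriv u x) x :=
  hu.hasDerivAt_of_ae hc (hu.ae_differentiableAt.mono fun _ h => h.hasDerivAt) hx

theorem acloc_primitive {h : ℝ → ℝ} (hh : IntervalIntegrable h volume 0 1) :
    ACloc fun x => ∫ t in (0 : ℝ)..x, h t := by
  intro a b ha hab hb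
  refine (hh.absolutelyContinuousOnInterval_intervalIntegral (c := 0) left_mem_uIcc).mono ?_
  rw [uIcc_of_le hab, uIcc_of_le zero_le_one]
  exact Icc_subset_Icc ha.le hb.le

theorem ae_hasDerivAt_primitive {h : ℝ → ℝ} (hh : IntervalIntegrable h volume 0 1) :
    ∀ᵐ x ∂volume.restrict (Ioo (0 : ℝ) 1),
      HasDerivAt (fun x => ∫ t in (0 : ℝ)..x, h t) (h x) x := by
  rw [ae_restrict_iff' measurableSet_Ioo]
  filter_upwards [hh.ae_hasDerivAt_integral] with x hx hx'
  exact hx (by rw [uIcc_of_le zero_le_one]; exact Ioo_subset_Icc_self hx') 0 left_mem_uIcc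

theorem continuousOn_primitive {h : ℝ → ℝ} (hh : IntervalIntegrable h volume 0 1) :
    ContinuousOn (fun x => ∫ t in (0 : ℝ)..x, h t) (Icc 0 1) := by
  have := intervalIntegral.continuousOn_primitive_interval' hh left_mem_uIcc
  rwa [uIcc_of_le zero_le_one] at this

/-- The fundamental theorem of calculus on `(0, 1)`, with limits at the endpoints. -/
theorem ACloc.integral_eq_sub {H h : ℝ → ℝ} {l₀ l₁ : ℝ} (hH : ACloc H)
    (hd : ∀ᵐ x ∂volume.restrict (Ioo (0 : ℝ) 1), HasDerivAt H (h x) x)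
    (hh : IntervalIntegrable h volume 0 1) (h0 : Tendsto H (𝓝[>] 0) (𝓝 l₀))
    (h1 : Tendsto H (𝓝[<] 1) (𝓝 l₁)) : ∫ x in (0 : ℝ)..1, h x = l₁ - l₀ := by
  set P : ℝ → ℝ := fun x => ∫ t in (0 : ℝ)..x, h t with hP
  -- `H` differs from the primitive of `h` by a constant, and the primitive is continuous up to both
  -- endpoints.
  obtain ⟨c, hc⟩ := (hH.sub (acloc_primitive hh)).eq_of_ae_hasDerivAt_zero (by
    filter_upwards [hd, ae_hasDerivAt_primitive hh] with x hx1 hx2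
    simpa using hx1.fun_sub hx2)
  have hPc := continuousOn_primitive hh
  have hP0 : Tendsto P (𝓝[>] 0) (𝓝 0) := by
    have := (hPc 0 (left_mem_Icc.2 zero_le_one)).tendsto
    simp only [intervalIntegral.integral_same] at this
    refine this.mono_left ?_
    rw [← nhdsWithin_Ioo_eq_nhdsGT (zero_lt_one' ℝ)]
    exact nhdsWithin_mono _ Ioo_subset_Icc_self
  have hP1 : Tendsto P (𝓝[<] 1) (𝓝 (P 1)) := by
    refine (hPc 1 (right_mem_Icc.2 zero_le_one)).tendsto.mono_left ?_
    rw [← nhdsWithin_Ioo_eq_nhdsLT (zero_lt_one' ℝ)]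
    exact nhdsWithin_mono _ Ioo_subset_Icc_self
  have e0 : (fun x => H x - P x) =ᶠ[𝓝[>] 0] fun _ => c := by
    filter_upwards [Ioo_mem_nhdsGT (zero_lt_one' ℝ)] with x hx using hc x hx
  have e1 : (fun x => H x - P x) =ᶠ[𝓝[<] 1] fun _ => c := by
    filter_upwards [Ioo_mem_nhdsLT (zero_lt_one' ℝ)] with x hx using hc x hx
  have c0 := tendsto_nhds_unique ((h0.sub hP0).congr' e0) tendsto_const_nhds
  have c1 := tendsto_nhds_unique ((h1.sub hP1).congr' e1) tendsto_const_nhds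
  change P 1 = _
  linarith

/-! ### The weighted primitive -/

/-- The primitive `z ↦ ∫₀ᶻ y ^ (s + β) f(y) dy`. -/
def prim (s β : ℝ) (f : ℝ → ℝ) (z : ℝ) : ℝ := ∫ y in (0 : ℝ)..z, y ^ (s + β) * f y

/-- The conclusion says that `y ^ s` lies in `L²_β`. It makes `prim` converge for `f` in `L²_β` and
is the standing hypothesis `h` below. -/
theorem neg_one_lt_add_two_mul {s β : ℝ} (hs : 0 < s) (hβ : -1 < β) : -1 < β + 2 * s := by
  linarith

/-- The class of `y ^ s` cut off at `z`. -/
def truncPow {s β : ℝ} (h : -1 < β + 2 * s) (z : ℝ) : L2w β :=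
  ((memLp_rpow_iff.2 h).indicator (measurableSet_Iic (a := z))).toLp _

theorem truncPow_coeFn {s β : ℝ} (h : -1 < β + 2 * s) (z : ℝ) :
    truncPow h z =ᵐ[weightedMeasure β] (Iic z).indicator fun y => y ^ s :=
  MemLp.coeFn_toLp _

theorem intervalIntegrable_prim {s β : ℝ} (h : -1 < β + 2 * s) {f : ℝ → ℝ}
    (hf : MemLp f 2 (weightedMeasure β)) :
    IntervalIntegrable (fun y => y ^ (s + β) * f y) volume 0 1 := by
  refine (integrable_mul_of_memLp (memLp_rpow_iff.2 h) hf).congr_ae ?_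
  rw [EventuallyEq, ae_restrict_iff' measurableSet_uIoc]
  refine Eventually.of_forall fun x hx => ?_
  rw [uIoc_of_le zero_le_one] at hx
  rw [Real.rpow_add hx.1]
  ring

/-- Seeing `prim` as an inner product with a fixed vector gives its bounds by Cauchy–Schwarz and
puts the Hardy operator in the form `innerOp`. -/
theorem inner_truncPow {s β : ℝ} (h : -1 < β + 2 * s) {f : L2w β} {u : ℝ → ℝ}
    (hu : f =ᵐ[weightedMeasure β] u) {z : ℝ} (hz : z ∈ Icc (0 : ℝ) 1) :
    inner ℝ (truncPow h z) f = prim s β u z := by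
  rw [inner_eq_of_ae (truncPow_coeFn h z) hu, prim,
    ← intervalIntegral.integral_indicator (f := fun y => y ^ (s + β) * u y) hz]
  refine intervalIntegral.integral_congr_ae (Eventually.of_forall fun x hx => ?_)
  rw [uIoc_of_le zero_le_one] at hx
  by_cases hxz : x ≤ z
  · rw [indicator_of_mem (show x ∈ Iic z from hxz), indicator_of_mem (by exact hxz),
      Real.rpow_add hx.1]
    ring
  · rw [indicator_of_notMem (show x ∉ Iic z from hxz), indicator_of_notMem (by exact hxz)]
    ring

theorem prim_congr {s β : ℝ} {u v : ℝ → ℝ} (huv : u =ᵐ[weightedMeasure β] v) {z : ℝ}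
    (hz : z ∈ Icc (0 : ℝ) 1) : prim s β u z = prim s β v z := by
  refine intervalIntegral.integral_congr_ae ?_
  rw [EventuallyEq, ae_weightedMeasure_iff, ae_restrict_iff' measurableSet_Ioo] at huv
  have h1 : ∀ᵐ x : ℝ, x ≠ 1 := by simp [ae_iff, measure_singleton]
  filter_upwards [huv, h1] with x hx hx1 hxz
  rw [uIoc_of_le hz.1] at hxz
  rw [hx ⟨hxz.1, lt_of_le_of_ne (hxz.2.trans hz.2) hx1⟩]

theorem inner_truncPow_truncPow {s β : ℝ} (h : -1 < β + 2 * s) {z w : ℝ} (hz : 0 < z)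
    (hzw : z ≤ w) (hw : w ≤ 1) :
    inner ℝ (truncPow h z) (truncPow h w) = z ^ (β + 2 * s + 1) / (β + 2 * s + 1) := by
  rw [inner_truncPow h (truncPow_coeFn h w) ⟨hz.le, hzw.trans hw⟩, prim]
  have e : ∀ y ∈ uIoc 0 z, y ^ (s + β) * (Iic w).indicator (fun y => y ^ s) y
      = y ^ (β + 2 * s) := fun y hy => by
    rw [uIoc_of_le hz.le] at hy
    rw [indicator_of_mem (show y ∈ Iic w from hy.2.trans hzw), ← Real.rpow_add hy.1]
    ring_nf
  rw [intervalIntegral.integral_congr_ae (Eventually.of_forall e), integral_rpow (Or.inl h),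
    Real.zero_rpow (by linarith), sub_zero]

theorem norm_truncPow_sq {s β : ℝ} (h : -1 < β + 2 * s) {z : ℝ} (hz : z ∈ Ioc (0 : ℝ) 1) :
    ‖truncPow h z‖ ^ 2 = z ^ (β + 2 * s + 1) / (β + 2 * s + 1) := by
  rw [← inner_truncPow_truncPow h hz.1 le_rfl hz.2, real_inner_self_eq_norm_sq]

theorem norm_truncPow {s β : ℝ} (h : -1 < β + 2 * s) {z : ℝ} (hz : z ∈ Ioc (0 : ℝ) 1) :
    ‖truncPow h z‖ = z ^ (s + (1 + β) / 2) * (√(β + 2 * s + 1))⁻¹ := by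
  have hpos : 0 < β + 2 * s + 1 := by linarith
  refine (sq_eq_sq₀ (norm_nonneg _) (mul_nonneg (Real.rpow_nonneg hz.1.le _)
    (inv_nonneg.2 (Real.sqrt_nonneg _)))).1 ?_
  rw [norm_truncPow_sq h hz, mul_pow, inv_pow, Real.sq_sqrt hpos.le, ← Real.rpow_natCast,
    ← Real.rpow_mul hz.1.le, div_eq_mul_inv]
  congr 2
  push_cast
  ring

/-- The exact distance shows that `truncPow` is continuous in `z`, from which the measurability of
the Hardy kernel follows. -/
theorem norm_truncPow_sub_sq {s β : ℝ} (h : -1 < β + 2 * s) {z w : ℝ} (hz : z ∈ Ioc (0 : ℝ) 1)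
    (hw : w ∈ Ioc (0 : ℝ) 1) :
    ‖truncPow h z - truncPow h w‖ ^ 2
      = |z ^ (β + 2 * s + 1) - w ^ (β + 2 * s + 1)| / (β + 2 * s + 1) := by
  have hpos : 0 < β + 2 * s + 1 := by linarith
  wlog hzw : z ≤ w generalizing z w
  · rw [norm_sub_rev, abs_sub_comm]
    exact this hw hz (le_of_not_ge hzw)
  rw [norm_sub_sq_real, norm_truncPow_sq h hz, norm_truncPow_sq h hw,
    inner_truncPow_truncPow h hz.1 hzw hw.2,
    abs_of_nonpos (sub_nonpos.2 (Real.rpow_le_rpow hz.1.le hzw hpos.le))]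
  ring

theorem continuousOn_truncPow {s β : ℝ} (h : -1 < β + 2 * s) :
    ContinuousOn (fun z => truncPow h z) (Ioo (0 : ℝ) 1) := by
  intro w hw
  rw [ContinuousWithinAt, tendsto_iff_norm_sub_tendsto_zero]
  have h1 : Tendsto (fun z : ℝ => √(|z ^ (β + 2 * s + 1) - w ^ (β + 2 * s + 1)|
      / (β + 2 * s + 1))) (𝓝[Ioo 0 1] w) (𝓝 0) := by
    have hc : ContinuousAt (fun z : ℝ => √(|z ^ (β + 2 * s + 1) - w ^ (β + 2 * s + 1)|
        / (β + 2 * s + 1))) w := by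
      have := Real.continuousAt_rpow_const w (β + 2 * s + 1) (Or.inl hw.1.ne')
      fun_prop
    simpa [ContinuousAt] using hc.tendsto.mono_left nhdsWithin_le_nhds
  refine h1.congr' ?_
  filter_upwards [self_mem_nhdsWithin] with z hz
  rw [← norm_truncPow_sub_sq h (Ioo_subset_Ioc_self hz) (Ioo_subset_Ioc_self hw),
    Real.sqrt_sq (norm_nonneg _)]

theorem exists_abs_prim_le {s β : ℝ} (h : -1 < β + 2 * s) {f : ℝ → ℝ}
    (hf : MemLp f 2 (weightedMeasure β)) :
    ∃ C, 0 ≤ C ∧ ∀ z ∈ Ioc (0 : ℝ) 1, |prim s β f z| ≤ C * z ^ (s + (1 + β) / 2) := by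
  refine ⟨(√(β + 2 * s + 1))⁻¹ * ‖hf.toLp f‖, by positivity, fun z hz => ?_⟩
  rw [← inner_truncPow h hf.coeFn_toLp (Ioc_subset_Icc_self hz)]
  refine (abs_real_inner_le_norm _ _).trans ?_
  rw [norm_truncPow h hz]
  apply le_of_eq
  ring

theorem continuousOn_prim {s β : ℝ} (h : -1 < β + 2 * s) {f : ℝ → ℝ}
    (hf : MemLp f 2 (weightedMeasure β)) : ContinuousOn (prim s β f) (Icc 0 1) :=
  continuousOn_primitive (intervalIntegrable_prim h hf)

theorem acloc_prim {s β : ℝ} (h : -1 < β + 2 * s) {f : ℝ → ℝ}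
    (hf : MemLp f 2 (weightedMeasure β)) : ACloc (prim s β f) :=
  acloc_primitive (intervalIntegrable_prim h hf)

theorem ae_hasDerivAt_prim {s β : ℝ} (h : -1 < β + 2 * s) {f : ℝ → ℝ}
    (hf : MemLp f 2 (weightedMeasure β)) :
    ∀ᵐ x ∂volume.restrict (Ioo (0 : ℝ) 1), HasDerivAt (prim s β f) (x ^ (s + β) * f x) x :=
  ae_hasDerivAt_primitive (intervalIntegrable_prim h hf)

theorem hasDerivAt_prim {s β : ℝ} (h : -1 < β + 2 * s) {f : ℝ → ℝ}
    (hf : MemLp f 2 (weightedMeasure β)) (hc : ContinuousOn f (Ioo 0 1)) {x : ℝ}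
    (hx : x ∈ Ioo (0 : ℝ) 1) : HasDerivAt (prim s β f) (x ^ (s + β) * f x) x := by
  have hcont : ContinuousOn (fun y => y ^ (s + β) * f y) (Ioo 0 1) :=
    (ACloc.rpow (s + β)).continuousOn.mul hc
  refine intervalIntegral.integral_hasDerivAt_right ?_ ?_ ?_
  · refine (intervalIntegrable_prim h hf).mono_set ?_
    rw [uIcc_of_le hx.1.le, uIcc_of_le zero_le_one]
    exact Icc_subset_Icc_right hx.2.le
  · exact hcont.stronglyMeasurableAtFilter isOpen_Ioo x hx
  · exact hcont.continuousAt (isOpen_Ioo.mem_nhds hx)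

/-! ### Green's operator -/

/-- The integral in the variation of constants formula. -/
def greenInt (s β : ℝ) (f : ℝ → ℝ) (x : ℝ) : ℝ :=
  ∫ z in x..1, z ^ (-2 * s - 1) * prim s β f z

/-- The solution `u` of `𝒜 u = f` with `u(1) = 0` that is small at `0`, for `μ = -s ^ 2`. -/
def green (s β : ℝ) (f : ℝ → ℝ) (x : ℝ) : ℝ := x ^ s * greenInt s β f x

/-- The flux `x ∂ₓ u` of `u = green s β f`. -/
def greenFlux (s β : ℝ) (f : ℝ → ℝ) (x : ℝ) : ℝ :=
  s * green s β f x - x ^ (-s) * prim s β f x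

theorem continuousOn_greenInt_integrand {s β : ℝ} (h : -1 < β + 2 * s) {f : ℝ → ℝ}
    (hf : MemLp f 2 (weightedMeasure β)) :
    ContinuousOn (fun z => z ^ (-2 * s - 1) * prim s β f z) (Ioc 0 1) :=
  ContinuousOn.mul (fun x hx => (Real.continuousAt_rpow_const x _
    (Or.inl hx.1.ne')).continuousWithinAt) ((continuousOn_prim h hf).mono Ioc_subset_Icc_self)

theorem intervalIntegrable_greenInt {s β : ℝ} (h : -1 < β + 2 * s) {f : ℝ → ℝ}
    (hf : MemLp f 2 (weightedMeasure β)) {x : ℝ} (hx : x ∈ Ioo (0 : ℝ) 1) :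
    IntervalIntegrable (fun z => z ^ (-2 * s - 1) * prim s β f z) volume x 1 := by
  refine ((continuousOn_greenInt_integrand h hf).mono ?_).intervalIntegrable
  rw [uIcc_of_le hx.2.le]
  exact fun z hz => ⟨hx.1.trans_le hz.1, hz.2⟩

theorem hasDerivAt_greenInt {s β : ℝ} (h : -1 < β + 2 * s) {f : ℝ → ℝ}
    (hf : MemLp f 2 (weightedMeasure β)) {x : ℝ} (hx : x ∈ Ioo (0 : ℝ) 1) :
    HasDerivAt (greenInt s β f) (-(x ^ (-2 * s - 1) * prim s β f x)) x := by
  have hc := (continuousOn_greenInt_integrand h hf).mono Ioo_subset_Ioc_self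
  exact intervalIntegral.integral_hasDerivAt_left (intervalIntegrable_greenInt h hf hx)
    (hc.stronglyMeasurableAtFilter isOpen_Ioo x hx) (hc.continuousAt (isOpen_Ioo.mem_nhds hx))

theorem green_congr {s β : ℝ} {u v : ℝ → ℝ} (huv : u =ᵐ[weightedMeasure β] v) {x : ℝ}
    (hx : x ∈ Ioo (0 : ℝ) 1) : green s β u x = green s β v x := by
  rw [green, green, greenInt, greenInt]
  congr 1
  refine intervalIntegral.integral_congr fun z hz => ?_
  rw [uIcc_of_le hx.2.le] at hz
  rw [prim_congr huv ⟨hx.1.le.trans hz.1, hz.2⟩]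

theorem hasDerivAt_green {s β : ℝ} (h : -1 < β + 2 * s) {f : ℝ → ℝ}
    (hf : MemLp f 2 (weightedMeasure β)) {x : ℝ} (hx : x ∈ Ioo (0 : ℝ) 1) :
    HasDerivAt (green s β f) (greenFlux s β f x / x) x := by
  have hx0 : 0 < x := hx.1
  refine ((Real.hasDerivAt_rpow_const (p := s) (Or.inl hx0.ne')).mul
    (hasDerivAt_greenInt h hf hx)).congr_deriv ?_
  have e1 : x ^ (s - 1) = x ^ s / x := by rw [Real.rpow_sub hx0, Real.rpow_one]
  have e2 : x ^ (-2 * s - 1) = x ^ (-s) * x ^ (-s) / x := by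
    rw [Real.rpow_sub hx0, Real.rpow_one, ← Real.rpow_add hx0]
    ring_nf
  have e3 : x ^ s * x ^ (-s) = 1 := by rw [← Real.rpow_add hx0]; simp
  rw [greenFlux, green, e1, e2]
  field_simp
  linear_combination (-(prim s β f x * x ^ (-s))) * e3

theorem continuousOn_green {s β : ℝ} (h : -1 < β + 2 * s) {f : ℝ → ℝ}
    (hf : MemLp f 2 (weightedMeasure β)) : ContinuousOn (green s β f) (Ioo 0 1) :=
  fun _ hx => (hasDerivAt_green h hf hx).continuousAt.continuousWithinAt

theorem continuousOn_greenFlux {s β : ℝ} (h : -1 < β + 2 * s) {f : ℝ → ℝ}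
    (hf : MemLp f 2 (weightedMeasure β)) : ContinuousOn (greenFlux s β f) (Ioo 0 1) :=
  (continuousOn_const.mul (continuousOn_green h hf)).sub
    ((ACloc.rpow (-s)).continuousOn.mul (acloc_prim h hf).continuousOn)

theorem acloc_green {s β : ℝ} (h : -1 < β + 2 * s) {f : ℝ → ℝ}
    (hf : MemLp f 2 (weightedMeasure β)) : ACloc (green s β f) :=
  ACloc.of_hasDerivAt (fun _ hx => hasDerivAt_green h hf hx)
    ((continuousOn_greenFlux h hf).div continuousOn_id fun _ hx => hx.1.ne')

theorem acloc_greenFlux {s β : ℝ} (h : -1 < β + 2 * s) {f : ℝ → ℝ}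
    (hf : MemLp f 2 (weightedMeasure β)) : ACloc (greenFlux s β f) :=
  ((acloc_green h hf).const_mul s).sub ((ACloc.rpow (-s)).mul (acloc_prim h hf))

theorem hasDerivAt_greenFlux {s β : ℝ} (h : -1 < β + 2 * s) {f : ℝ → ℝ}
    (hf : MemLp f 2 (weightedMeasure β)) {x : ℝ} (hx : x ∈ Ioo (0 : ℝ) 1)
    (hp : HasDerivAt (prim s β f) (x ^ (s + β) * f x) x) :
    HasDerivAt (greenFlux s β f) (s ^ 2 * green s β f x / x - x ^ β * f x) x := by
  have hx0 : 0 < x := hx.1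
  refine (((hasDerivAt_green h hf hx).const_mul s).sub
    ((Real.hasDerivAt_rpow_const (p := -s) (Or.inl hx0.ne')).mul hp)).congr_deriv ?_
  have e1 : x ^ (-s - 1) = x ^ (-s) / x := by rw [Real.rpow_sub hx0, Real.rpow_one]
  have e2 : x ^ (s + β) = x ^ s * x ^ β := Real.rpow_add hx0 _ _
  have e3 : x ^ s * x ^ (-s) = 1 := by rw [← Real.rpow_add hx0]; simp
  rw [greenFlux, e1, e2]
  field_simp
  linear_combination (-(x * x ^ β * f x)) * e3

theorem exists_abs_greenInt_le {s β : ℝ} (hs : 0 < s) (hβ : -1 < β) {f : ℝ → ℝ}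
    (hf : MemLp f 2 (weightedMeasure β)) :
    ∃ C δ : ℝ, 0 ≤ C ∧ 0 < δ ∧ ∀ x ∈ Ioo (0 : ℝ) 1, |greenInt s β f x| ≤ C * x ^ (δ - s) := by
  obtain ⟨C, hC, hb⟩ := exists_abs_prim_le (neg_one_lt_add_two_mul hs hβ) hf
  -- The natural decay exponent `(1 + β) / 2` is lowered below `s`. Then `δ - s < 0`, so no
  -- logarithm arises from the integral and the contribution of the endpoint `1` has a favourable
  -- sign.
  set δ := min ((1 + β) / 2) (s / 2) with hδ
  have hδ0 : 0 < δ := lt_min (by linarith) (by linarith)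
  have hδs : δ < s := (min_le_right _ _).trans_lt (by linarith)
  refine ⟨C / (s - δ), δ, div_nonneg hC (by linarith), hδ0, fun x hx => ?_⟩
  have hx0 : 0 < x := hx.1
  have hint : IntervalIntegrable (fun z : ℝ => C * z ^ (δ - s - 1)) volume x 1 := by
    refine (intervalIntegral.intervalIntegrable_rpow (Or.inr ?_)).const_mul C
    rw [uIcc_of_le hx.2.le]
    exact fun h0 => absurd h0.1 (not_le.2 hx0)
  have h1 : |greenInt s β f x| ≤ ∫ z in x..1, C * z ^ (δ - s - 1) := by
    rw [greenInt, ← Real.norm_eq_abs]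
    refine intervalIntegral.norm_integral_le_of_norm_le hx.2.le
      (Eventually.of_forall fun z hz => ?_) hint
    have hz0 : 0 < z := hx0.trans hz.1
    rw [Real.norm_eq_abs, abs_mul, abs_of_nonneg (Real.rpow_nonneg hz0.le _)]
    calc z ^ (-2 * s - 1) * |prim s β f z|
        ≤ z ^ (-2 * s - 1) * (C * z ^ (s + (1 + β) / 2)) := by
          gcongr
          exact hb z ⟨hz0, hz.2⟩
      _ = C * z ^ ((1 + β) / 2 - s - 1) := by
          rw [mul_left_comm, ← Real.rpow_add hz0]
          ring_nf
      _ ≤ C * z ^ (δ - s - 1) := by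
          refine mul_le_mul_of_nonneg_left ?_ hC
          refine Real.rpow_le_rpow_of_exponent_ge hz0 hz.2 ?_
          linarith [min_le_left ((1 + β) / 2) (s / 2)]
  refine h1.trans ?_
  rw [intervalIntegral.integral_const_mul, integral_rpow (Or.inr ⟨by linarith, fun h0 => by
      rw [uIcc_of_le hx.2.le] at h0
      exact absurd h0.1 (not_le.2 hx0)⟩), Real.one_rpow, sub_add_cancel, div_mul_eq_mul_div,
    mul_div_assoc]
  refine mul_le_mul_of_nonneg_left ?_ hC
  rw [← neg_div_neg_eq, neg_sub, neg_sub]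
  refine div_le_div_of_nonneg_right (by linarith) (by linarith)

theorem exists_abs_green_le {s β : ℝ} (hs : 0 < s) (hβ : -1 < β) {f : ℝ → ℝ}
    (hf : MemLp f 2 (weightedMeasure β)) :
    ∃ C δ : ℝ, 0 ≤ C ∧ 0 < δ ∧ ∀ x ∈ Ioo (0 : ℝ) 1, |green s β f x| ≤ C * x ^ δ := by
  obtain ⟨C, δ, hC, hδ, hb⟩ := exists_abs_greenInt_le hs hβ hf
  refine ⟨C, δ, hC, hδ, fun x hx => ?_⟩
  rw [green, abs_mul, abs_of_nonneg (Real.rpow_nonneg hx.1.le _)]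
  calc x ^ s * |greenInt s β f x| ≤ x ^ s * (C * x ^ (δ - s)) := by
        gcongr
        · exact Real.rpow_nonneg hx.1.le _
        · exact hb x hx
    _ = C * x ^ δ := by
        rw [mul_left_comm, ← Real.rpow_add hx.1]
        ring_nf

theorem tendsto_rpow_nhdsGT_zero {r : ℝ} (hr : 0 < r) :
    Tendsto (fun x : ℝ => x ^ r) (𝓝[>] 0) (𝓝 0) := by
  have := (Real.continuousAt_rpow_const 0 r (Or.inr hr.le)).tendsto
  rw [Real.zero_rpow hr.ne'] at this
  exact this.mono_left nhdsWithin_le_nhds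

theorem tendsto_zero_of_abs_le_rpow {u : ℝ → ℝ} {C δ : ℝ} (hδ : 0 < δ)
    (h : ∀ x ∈ Ioo (0 : ℝ) 1, |u x| ≤ C * x ^ δ) : Tendsto u (𝓝[>] 0) (𝓝 0) := by
  refine squeeze_zero_norm' ?_ (by simpa using (tendsto_rpow_nhdsGT_zero hδ).const_mul C)
  filter_upwards [Ioo_mem_nhdsGT (zero_lt_one' ℝ)] with x hx using h x hx

theorem tendsto_green_zero {s β : ℝ} (hs : 0 < s) (hβ : -1 < β) {f : ℝ → ℝ}
    (hf : MemLp f 2 (weightedMeasure β)) : Tendsto (green s β f) (𝓝[>] 0) (𝓝 0) := by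
  obtain ⟨C, δ, -, hδ, hb⟩ := exists_abs_green_le hs hβ hf
  exact tendsto_zero_of_abs_le_rpow hδ hb

theorem tendsto_greenFlux_zero {s β : ℝ} (hs : 0 < s) (hβ : -1 < β) {f : ℝ → ℝ}
    (hf : MemLp f 2 (weightedMeasure β)) : Tendsto (greenFlux s β f) (𝓝[>] 0) (𝓝 0) := by
  obtain ⟨C, hC, hb⟩ := exists_abs_prim_le (neg_one_lt_add_two_mul hs hβ) hf
  have h1 : Tendsto (fun x => x ^ (-s) * prim s β f x) (𝓝[>] 0) (𝓝 0) := by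
    refine tendsto_zero_of_abs_le_rpow (C := C) (δ := (1 + β) / 2) (by linarith) fun x hx => ?_
    rw [abs_mul, abs_of_nonneg (Real.rpow_nonneg hx.1.le _)]
    calc x ^ (-s) * |prim s β f x| ≤ x ^ (-s) * (C * x ^ (s + (1 + β) / 2)) := by
          gcongr
          · exact Real.rpow_nonneg hx.1.le _
          · exact hb x ⟨hx.1, hx.2.le⟩
      _ = C * x ^ ((1 + β) / 2) := by
          rw [mul_left_comm, ← Real.rpow_add hx.1]
          ring_nf
  simpa using! ((tendsto_green_zero hs hβ hf).const_mul s).sub h1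

theorem tendsto_greenInt_one {s β : ℝ} (h : -1 < β + 2 * s) {f : ℝ → ℝ}
    (hf : MemLp f 2 (weightedMeasure β)) : Tendsto (greenInt s β f) (𝓝[<] 1) (𝓝 0) := by
  have hI : IntervalIntegrable (fun z => z ^ (-2 * s - 1) * prim s β f z) volume (1 / 2) 1 :=
    intervalIntegrable_greenInt h hf (by norm_num)
  have hc := intervalIntegral.continuousOn_primitive_interval_left
    ((intervalIntegrable_iff_integrableOn_Icc_of_le (by norm_num)).1 hI |>.mono_set
      (by rw [uIcc_of_le (by norm_num : (1 / 2 : ℝ) ≤ 1)]))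
  rw [uIcc_of_le (by norm_num : (1 / 2 : ℝ) ≤ 1)] at hc
  have h1 := (hc 1 (right_mem_Icc.2 (by norm_num))).tendsto
  rw [intervalIntegral.integral_same] at h1
  refine h1.mono_left ?_
  rw [← nhdsWithin_Ioo_eq_nhdsLT (by norm_num : (1 / 2 : ℝ) < 1)]
  exact nhdsWithin_mono _ Ioo_subset_Icc_self

theorem tendsto_rpow_nhdsLT_one (r : ℝ) : Tendsto (fun x : ℝ => x ^ r) (𝓝[<] 1) (𝓝 1) := by
  have := (Real.continuousAt_rpow_const 1 r (Or.inl one_ne_zero)).tendsto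
  rw [Real.one_rpow] at this
  exact this.mono_left nhdsWithin_le_nhds

theorem tendsto_green_one {s β : ℝ} (h : -1 < β + 2 * s) {f : ℝ → ℝ}
    (hf : MemLp f 2 (weightedMeasure β)) : Tendsto (green s β f) (𝓝[<] 1) (𝓝 0) := by
  simpa using! (tendsto_rpow_nhdsLT_one s).mul (tendsto_greenInt_one h hf)

theorem tendsto_prim_one {s β : ℝ} (h : -1 < β + 2 * s) {f : ℝ → ℝ}
    (hf : MemLp f 2 (weightedMeasure β)) :
    Tendsto (prim s β f) (𝓝[<] 1) (𝓝 (prim s β f 1)) := by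
  refine (continuousOn_prim h hf 1 (right_mem_Icc.2 zero_le_one)).tendsto.mono_left ?_
  rw [← nhdsWithin_Ioo_eq_nhdsLT (zero_lt_one' ℝ)]
  exact nhdsWithin_mono _ Ioo_subset_Icc_self

theorem tendsto_greenFlux_one {s β : ℝ} (h : -1 < β + 2 * s) {f : ℝ → ℝ}
    (hf : MemLp f 2 (weightedMeasure β)) :
    Tendsto (greenFlux s β f) (𝓝[<] 1) (𝓝 (-prim s β f 1)) := by
  simpa using! ((tendsto_green_one h hf).const_mul s).sub
    ((tendsto_rpow_nhdsLT_one (-s)).mul (tendsto_prim_one h hf))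

theorem memLp_green {s β : ℝ} (hs : 0 < s) (hβ : -1 < β) {f : ℝ → ℝ}
    (hf : MemLp f 2 (weightedMeasure β)) : MemLp (green s β f) 2 (weightedMeasure β) := by
  obtain ⟨C, δ, hC, hδ, hb⟩ := exists_abs_green_le hs hβ hf
  refine memLp_of_continuousOn_of_bound (C := C) hβ
    (continuousOn_green (neg_one_lt_add_two_mul hs hβ) hf) fun x hx => (hb x hx).trans ?_
  exact mul_le_of_le_one_right hC (Real.rpow_le_one hx.1.le hx.2.le hδ.le)

/-! ### Green's operator on `L²_β` -/

/-- The kernel of the Hardy operator `f ↦ z ^ (-s - (1 + β) / 2) * prim s β f z`. -/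
def hardyKernel {s β : ℝ} (h : -1 < β + 2 * s) (z : ℝ) : L2w β :=
  z ^ (-s - (1 + β) / 2) • truncPow h z

/-- The power `z ^ (-s - (1 + β) / 2)` cancels the growth of `‖truncPow h z‖` exactly, so the kernel
has constant norm, and the measure is finite. -/
theorem memLp_hardyKernel {s β : ℝ} (hβ : -1 < β) (h : -1 < β + 2 * s) :
    MemLp (hardyKernel h) 2 (weightedMeasure β) := by
  have := isFiniteMeasure_weightedMeasure hβ
  refine MemLp.of_bound (C := (√(β + 2 * s + 1))⁻¹) (aestronglyMeasurable_weightedMeasure ?_)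
    (ae_weightedMeasure_of_forall fun z hz => ?_)
  · exact (ACloc.rpow _).continuousOn.smul (continuousOn_truncPow h)
  · rw [hardyKernel, norm_smul, Real.norm_eq_abs, abs_of_nonneg (Real.rpow_nonneg hz.1.le _),
      norm_truncPow h (Ioo_subset_Ioc_self hz), ← mul_assoc, ← Real.rpow_add hz.1]
    ring_nf
    simp

/-- The Hardy operator. -/
def hardyOp {s β : ℝ} (hβ : -1 < β) (h : -1 < β + 2 * s) : L2w β →L[ℝ] L2w β :=
  innerOp (hardyKernel h) (memLp_hardyKernel hβ h)

theorem hardyOp_coeFn {s β : ℝ} (hβ : -1 < β) (h : -1 < β + 2 * s) {f : L2w β} {u : ℝ → ℝ}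
    (hu : f =ᵐ[weightedMeasure β] u) :
    hardyOp hβ h f =ᵐ[weightedMeasure β] fun z => z ^ (-s - (1 + β) / 2) * prim s β u z := by
  refine (innerOp_coeFn _ f).trans (ae_weightedMeasure_of_forall fun z hz => ?_)
  simp only [hardyKernel]
  rw [real_inner_smul_left, inner_truncPow h hu (Ioo_subset_Icc_self hz)]

/-- Green's operator, as a positive operator. -/
def greenOp {s β : ℝ} (hβ : -1 < β) (h : -1 < β + 2 * s) : L2w β →L[ℝ] L2w β :=
  (ContinuousLinearMap.adjoint (hardyOp hβ h)).comp (hardyOp hβ h)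

theorem isCompactOperator_greenOp {s β : ℝ} (hβ : -1 < β) (h : -1 < β + 2 * s) :
    IsCompactOperator (greenOp hβ h) :=
  (isCompactOperator_innerOp (memLp_hardyKernel hβ h)).clm_comp
    (ContinuousLinearMap.adjoint (hardyOp hβ h))

theorem inner_greenOp_left {s β : ℝ} (hβ : -1 < β) (h : -1 < β + 2 * s) (f g : L2w β) :
    inner ℝ (greenOp hβ h f) g = inner ℝ (hardyOp hβ h f) (hardyOp hβ h g) := by
  rw [greenOp, ContinuousLinearMap.comp_apply, ContinuousLinearMap.adjoint_inner_left]

theorem isSymmetric_greenOp {s β : ℝ} (hβ : -1 < β) (h : -1 < β + 2 * s) :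
    (greenOp hβ h : L2w β →ₗ[ℝ] L2w β).IsSymmetric := fun f g => by
  change inner ℝ (greenOp hβ h f) g = inner ℝ f (greenOp hβ h g)
  rw [inner_greenOp_left, real_inner_comm (greenOp hβ h g), inner_greenOp_left, real_inner_comm]

/-- If the image is zero then `prim s β f` vanishes on `(0, 1)` by continuity, and differentiating
it almost everywhere recovers `f = 0`. -/
theorem injective_hardyOp {s β : ℝ} (hβ : -1 < β) (h : -1 < β + 2 * s) :
    Function.Injective (hardyOp hβ h) := by
  rw [injective_iff_map_eq_zero]
  intro f hf
  have hmem := Lp.memLp f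
  have h1 : ∀ᵐ z ∂weightedMeasure β, z ^ (-s - (1 + β) / 2) * prim s β f z = 0 := by
    filter_upwards [hardyOp_coeFn hβ h (ae_eq_refl f), Lp.coeFn_zero ℝ 2 (weightedMeasure β)]
      with z hz h0
    rw [← hz, hf, h0, Pi.zero_apply]
  rw [ae_weightedMeasure_iff] at h1
  have h2 : EqOn (prim s β f) (fun _ => 0) (Ioo 0 1) := by
    refine Measure.eqOn_open_of_ae_eq (μ := volume) ?_ isOpen_Ioo (acloc_prim h hmem).continuousOn
      continuousOn_const
    filter_upwards [h1, ae_restrict_mem measurableSet_Ioo] with z hz hz1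
    exact (mul_eq_zero.1 hz).resolve_left (Real.rpow_pos_of_pos hz1.1 _).ne'
  rw [Lp.eq_zero_iff_ae_eq_zero, EventuallyEq, ae_weightedMeasure_iff]
  filter_upwards [ae_hasDerivAt_prim h hmem, ae_restrict_mem measurableSet_Ioo] with z hz hz1
  have h3 : HasDerivAt (prim s β f) 0 z :=
    (hasDerivAt_const z (0 : ℝ)).congr_of_eventuallyEq
      (eventually_of_mem (isOpen_Ioo.mem_nhds hz1) h2)
  exact (mul_eq_zero.1 (hz.unique h3)).resolve_left (Real.rpow_pos_of_pos hz1.1 _).ne'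

theorem inner_greenOp_self {s β : ℝ} (hβ : -1 < β) (h : -1 < β + 2 * s) (f : L2w β) :
    inner ℝ (greenOp hβ h f) f = ‖hardyOp hβ h f‖ ^ 2 := by
  rw [inner_greenOp_left, real_inner_self_eq_norm_sq]

theorem injective_greenOp {s β : ℝ} (hβ : -1 < β) (h : -1 < β + 2 * s) :
    Function.Injective (greenOp hβ h) := by
  rw [injective_iff_map_eq_zero]
  intro f hf
  have h1 := inner_greenOp_self hβ h f
  rw [hf, inner_zero_left] at h1
  refine (injective_iff_map_eq_zero _).1 (injective_hardyOp hβ h) f ?_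
  rw [← norm_eq_zero]
  exact pow_eq_zero_iff two_ne_zero |>.1 h1.symm

/-- Integration by parts for Green's operator. -/
theorem integral_green_mul {s β : ℝ} (hs : 0 < s) (hβ : -1 < β) {f g : ℝ → ℝ}
    (hf : MemLp f 2 (weightedMeasure β)) (hg : MemLp g 2 (weightedMeasure β))
    (hPf : MemLp (fun z => z ^ (-s - (1 + β) / 2) * prim s β f z) 2 (weightedMeasure β))
    (hPg : MemLp (fun z => z ^ (-s - (1 + β) / 2) * prim s β g z) 2 (weightedMeasure β)) :
    ∫ x in (0 : ℝ)..1, x ^ β * (green s β f x * g x)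
      = ∫ x in (0 : ℝ)..1, x ^ β * ((x ^ (-s - (1 + β) / 2) * prim s β f x) *
          (x ^ (-s - (1 + β) / 2) * prim s β g x)) := by
  have h := neg_one_lt_add_two_mul hs hβ
  have i1 := integrable_mul_of_memLp (memLp_green hs hβ hf) hg
  have i2 := integrable_mul_of_memLp hPf hPg
  rw [← sub_eq_zero, ← intervalIntegral.integral_sub i1 i2]
  -- The difference of the two integrands is the derivative of this product, which tends to `0` at
  -- both endpoints.
  have hac : ACloc fun x => greenInt s β f x * prim s β g x := by
    refine ACloc.mul (ACloc.of_hasDerivAt (fun x hx => hasDerivAt_greenInt h hf hx) ?_)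
      (acloc_prim h hg)
    exact ((continuousOn_greenInt_integrand h hf).mono Ioo_subset_Ioc_self).neg
  have h0 : Tendsto (fun x => greenInt s β f x * prim s β g x) (𝓝[>] 0) (𝓝 0) := by
    obtain ⟨C, δ, hC, hδ, hb⟩ := exists_abs_greenInt_le hs hβ hf
    obtain ⟨D, hD, hb'⟩ := exists_abs_prim_le h hg
    refine tendsto_zero_of_abs_le_rpow (C := C * D) (δ := δ + (1 + β) / 2) (by linarith)
      fun x hx => ?_
    rw [abs_mul]
    calc |greenInt s β f x| * |prim s β g x|
        ≤ (C * x ^ (δ - s)) * (D * x ^ (s + (1 + β) / 2)) := by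
          gcongr
          · exact mul_nonneg hC (Real.rpow_nonneg hx.1.le _)
          · exact hb x hx
          · exact hb' x ⟨hx.1, hx.2.le⟩
      _ = C * D * x ^ (δ + (1 + β) / 2) := by
          rw [mul_mul_mul_comm, ← Real.rpow_add hx.1]
          ring_nf
  have h1 : Tendsto (fun x => greenInt s β f x * prim s β g x) (𝓝[<] 1) (𝓝 0) := by
    simpa using (tendsto_greenInt_one h hf).mul (tendsto_prim_one h hg)
  have key := hac.integral_eq_sub (l₀ := 0) (l₁ := 0) ?_ (i1.sub i2) h0 h1
  · rw [key, sub_zero]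
  · filter_upwards [ae_hasDerivAt_prim h hg, ae_restrict_mem measurableSet_Ioo] with x hx hx01
    have hx0 : 0 < x := hx01.1
    refine ((hasDerivAt_greenInt h hf hx01).mul hx).congr_deriv ?_
    have e1 : x ^ (-2 * s - 1)
        = x ^ β * (x ^ (-s - (1 + β) / 2) * x ^ (-s - (1 + β) / 2)) := by
      rw [← Real.rpow_add hx0, ← Real.rpow_add hx0]
      ring_nf
    rw [e1, green, Real.rpow_add hx0]
    ring

/-- The abstract `H* H` is identified with the explicit solution formula by testing against an
arbitrary `g`. -/
theorem greenOp_coeFn {s β : ℝ} (hs : 0 < s) (hβ : -1 < β) (h : -1 < β + 2 * s) {f : L2w β}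
    {u : ℝ → ℝ} (hu : f =ᵐ[weightedMeasure β] u) :
    greenOp hβ h f =ᵐ[weightedMeasure β] green s β u := by
  have hmem : MemLp u 2 (weightedMeasure β) := (memLp_congr_ae hu).1 (Lp.memLp f)
  have hgr := memLp_green hs hβ hmem
  have key : greenOp hβ h f = hgr.toLp _ := by
    refine ext_inner_right ℝ fun g => ?_
    have hPf := hardyOp_coeFn hβ h hu
    have hPg := hardyOp_coeFn hβ h (ae_eq_refl g)
    rw [inner_greenOp_left, inner_eq_of_ae hPf hPg, inner_eq_of_ae hgr.coeFn_toLp (ae_eq_refl g),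
      integral_green_mul hs hβ hmem (Lp.memLp g) ((memLp_congr_ae hPf).1 (Lp.memLp _))
        ((memLp_congr_ae hPg).1 (Lp.memLp _))]
  rw [key]
  exact hgr.coeFn_toLp

/-! ### The second order operator -/

/-- With the flux `U = x u'` one has `x ^ α u' = x ^ (α - 1) U`. Expanding the derivative, the terms
in `U` without derivative add up to `(α - 1 + β) x ^ (α - 2) U = 0`. -/
theorem opA_eq_of_hasDerivAt {α β μ x U' : ℝ} {u : ℝ → ℝ} (hαβ : α + β = 1) (hx : 0 < x)
    (h : HasDerivAt (fun y => y * deriv u y) U' x) :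
    opA α β μ u x = -(x ^ (-β) * (U' + μ * u x / x)) := by
  have h1 : HasDerivAt (fun y => y ^ α * deriv u y)
      ((α - 1) * x ^ (α - 1 - 1) * (x * deriv u x) + x ^ (α - 1) * U') x := by
    refine ((Real.hasDerivAt_rpow_const (p := α - 1) (Or.inl hx.ne')).mul h).congr_of_eventuallyEq ?_
    filter_upwards [lt_mem_nhds hx] with y hy
    rw [Pi.mul_apply, Real.rpow_sub hy, Real.rpow_one]
    field_simp
  have eβ : β = 1 - α := by linarith
  rw [opA, h1.deriv, eβ, neg_sub, Real.rpow_sub hx 2, Real.rpow_sub hx, Real.rpow_sub hx,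
    Real.rpow_one, Real.rpow_two]
  have := (Real.rpow_pos_of_pos hx α).ne'
  field_simp
  ring

theorem deriv_green {s β : ℝ} (h : -1 < β + 2 * s) {f : ℝ → ℝ}
    (hf : MemLp f 2 (weightedMeasure β)) :
    EqOn (fun x => x * deriv (green s β f) x) (greenFlux s β f) (Ioo 0 1) := fun x hx => by
  have := hx.1.ne'
  simp only
  rw [(hasDerivAt_green h hf hx).deriv]
  field_simp

theorem opA_green {α s β : ℝ} (hαβ : α + β = 1) (h : -1 < β + 2 * s) {f : ℝ → ℝ}
    (hf : MemLp f 2 (weightedMeasure β)) {x : ℝ} (hx : x ∈ Ioo (0 : ℝ) 1)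
    (hp : HasDerivAt (prim s β f) (x ^ (s + β) * f x) x) :
    opA α β (-s ^ 2) (green s β f) x = f x := by
  rw [opA_eq_of_hasDerivAt hαβ hx.1 ((hasDerivAt_greenFlux h hf hx hp).congr_of_eventuallyEq
    (eventually_of_mem (isOpen_Ioo.mem_nhds hx) (deriv_green h hf)))]
  have e : x ^ (-β) * x ^ β = 1 := by rw [← Real.rpow_add hx.1]; simp
  linear_combination f x * e

theorem ae_opA_green {α s β : ℝ} (hαβ : α + β = 1) (h : -1 < β + 2 * s) {f : ℝ → ℝ}
    (hf : MemLp f 2 (weightedMeasure β)) :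
    opA α β (-s ^ 2) (green s β f) =ᵐ[weightedMeasure β] f := by
  rw [EventuallyEq, ae_weightedMeasure_iff]
  filter_upwards [ae_hasDerivAt_prim h hf, ae_restrict_mem measurableSet_Ioo] with x hx hx01
  exact opA_green hαβ h hf hx01 hx

theorem green_mem_Dmax {α s β : ℝ} (hαβ : α + β = 1) (hs : 0 < s) (hβ : -1 < β) {f : ℝ → ℝ}
    (hf : MemLp f 2 (weightedMeasure β)) : green s β f ∈ Dmax α β (-s ^ 2) := by
  have h := neg_one_lt_add_two_mul hs hβ
  exact ⟨acloc_green h hf, (acloc_greenFlux h hf).congr (deriv_green h hf).symm,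
    memLp_green hs hβ hf, (memLp_congr_ae (ae_opA_green hαβ h hf)).2 hf⟩

theorem hasDerivAt_of_mem_Dmax {α β μ : ℝ} {u : ℝ → ℝ} (hu : u ∈ Dmax α β μ) {x : ℝ}
    (hx : x ∈ Ioo (0 : ℝ) 1) : HasDerivAt u (deriv u x) x := by
  refine hu.1.hasDerivAt_deriv ?_ hx
  refine (hu.2.1.continuousOn.div continuousOn_id fun y hy => hy.1.ne').congr fun y hy => ?_
  have := hy.1.ne'
  simp [this]

/-- Variation of constants: a function in the maximal domain differs from
`green s β (𝒜 u)` by a solution of the homogeneous equation. -/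
theorem exists_eq_green_add {α s β : ℝ} (hαβ : α + β = 1) (hs : 0 < s) (hβ : -1 < β) {u : ℝ → ℝ}
    (hu : u ∈ Dmax α β (-s ^ 2)) (h1 : Tendsto u (𝓝[<] 1) (𝓝 0)) :
    ∃ c, ∀ x ∈ Ioo (0 : ℝ) 1,
      u x = green s β (opA α β (-s ^ 2) u) x + c * (x ^ s - x ^ (-s)) := by
  have h := neg_one_lt_add_two_mul hs hβ
  set f := opA α β (-s ^ 2) u with hf_def
  have hf : MemLp f 2 (weightedMeasure β) := hu.2.2.2
  -- First integration: `(x ^ s (U - s u))' = x ^ s (U' - s ^ 2 u / x) = -x ^ (s + β) f`, which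
  -- `prim` compensates.
  have hP : ACloc fun x => x ^ s * (x * deriv u x - s * u x) + prim s β f x :=
    ((ACloc.rpow s).mul (hu.2.1.sub (hu.1.const_mul s))).add (acloc_prim h hf)
  obtain ⟨c, hc⟩ := hP.eq_of_ae_hasDerivAt_zero (by
    filter_upwards [hu.2.1.ae_differentiableAt, ae_hasDerivAt_prim h hf,
      ae_restrict_mem measurableSet_Ioo] with x hx hp hx01
    have hx0 : 0 < x := hx01.1
    refine (((Real.hasDerivAt_rpow_const (p := s) (Or.inl hx0.ne')).mul
      (hx.hasDerivAt.sub ((hasDerivAt_of_mem_Dmax hu hx01).const_mul s))).add hp).congr_deriv ?_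
    have e : f x = _ := opA_eq_of_hasDerivAt hαβ hx0 hx.hasDerivAt
    have e' : x ^ β * x ^ (-β) = 1 := by rw [← Real.rpow_add hx0]; simp
    rw [e, Real.rpow_add hx0, Real.rpow_sub hx0, Real.rpow_one, Pi.sub_apply]
    set U' := deriv (fun y => y * deriv u y) x
    field_simp
    linear_combination (-(x ^ s * (x * U' - s ^ 2 * u x))) * e')
  -- Second integration: `(y ^ (-s) u)' = y ^ (-2 s - 1) (c - prim)`. The term with `c / (2 s)`
  -- absorbs the constant `c`; the limit at `1` then fixes the new constant.
  have hQ : ∀ x ∈ Ioo (0 : ℝ) 1, HasDerivAt (fun y => y ^ (-s) * u y - greenInt s β f y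
      + c / (2 * s) * y ^ (-2 * s)) 0 x := fun x hx => by
    have hx0 : 0 < x := hx.1
    refine ((((Real.hasDerivAt_rpow_const (p := -s) (Or.inl hx0.ne')).mul
      (hasDerivAt_of_mem_Dmax hu hx)).sub (hasDerivAt_greenInt h hf hx)).add
      ((Real.hasDerivAt_rpow_const (p := -2 * s) (Or.inl hx0.ne')).const_mul
        (c / (2 * s)))).congr_deriv ?_
    have hcx := hc x hx
    have e1 : x ^ (-s - 1) = x ^ (-s) / x := by rw [Real.rpow_sub hx0, Real.rpow_one]
    have e2 : x ^ (-2 * s - 1) = x ^ (-s) * x ^ (-s) / x := by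
      rw [Real.rpow_sub hx0, Real.rpow_one, ← Real.rpow_add hx0]
      ring_nf
    have e3 : x ^ s * x ^ (-s) = 1 := by rw [← Real.rpow_add hx0]; simp
    rw [e1, e2]
    field_simp
    linear_combination x ^ (-s) * x ^ (-s) * hcx - (x * deriv u x - s * u x) * x ^ (-s) * e3
  obtain ⟨d, hd⟩ := (ACloc.of_hasDerivAt hQ continuousOn_const).eq_of_ae_hasDerivAt_zero
    ((ae_restrict_mem measurableSet_Ioo).mono hQ)
  have hlim : Tendsto (fun y => y ^ (-s) * u y - greenInt s β f y + c / (2 * s) * y ^ (-2 * s))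
      (𝓝[<] 1) (𝓝 (c / (2 * s))) := by
    simpa using (((tendsto_rpow_nhdsLT_one (-s)).mul h1).sub (tendsto_greenInt_one h hf)).add
      ((tendsto_rpow_nhdsLT_one (-2 * s)).const_mul (c / (2 * s)))
  have hdc : d = c / (2 * s) := by
    refine tendsto_nhds_unique (tendsto_const_nhds.congr' ?_) hlim
    filter_upwards [Ioo_mem_nhdsLT (zero_lt_one' ℝ)] with x hx using (hd x hx).symm
  refine ⟨c / (2 * s), fun x hx => ?_⟩
  have hx0 : 0 < x := hx.1
  have h2 := hd x hx
  rw [hdc] at h2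
  have e2 : x ^ (-2 * s) = x ^ (-s) * x ^ (-s) := by
    rw [← Real.rpow_add hx0]
    ring_nf
  have e3 : x ^ s * x ^ (-s) = 1 := by rw [← Real.rpow_add hx0]; simp
  rw [e2] at h2
  rw [green]
  linear_combination x ^ s * h2 - (u x + c / (2 * s) * x ^ (-s)) * e3

/-- The boundary conditions determine `u` from `𝒜 u`. -/
theorem eq_green_opA {α s β : ℝ} (hαβ : α + β = 1) (hs : 0 < s) (hβ : -1 < β) {u : ℝ → ℝ}
    (hu : u ∈ Dmax α β (-s ^ 2)) (h1 : Tendsto u (𝓝[<] 1) (𝓝 0))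
    (h0 : s < (1 + β) / 2 → Tendsto (fun x => x ^ s * u x) (𝓝[>] 0) (𝓝 0)) {x : ℝ}
    (hx : x ∈ Ioo (0 : ℝ) 1) : u x = green s β (opA α β (-s ^ 2) u) x := by
  have hf : MemLp (opA α β (-s ^ 2) u) 2 (weightedMeasure β) := hu.2.2.2
  obtain ⟨c, hc⟩ := exists_eq_green_add hαβ hs hβ hu h1
  suffices hc0 : c = 0 by rw [hc x hx, hc0]; ring
  by_contra hne
  -- Here `x ^ s u` tends to `-c` at `0`, so the boundary condition forces `c = 0`.
  by_cases hsκ : s < (1 + β) / 2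
  · have hlim : Tendsto (fun x => x ^ s * green s β (opA α β (-s ^ 2) u) x
        + c * (x ^ (2 * s) - 1)) (𝓝[>] 0) (𝓝 (-c)) := by
      simpa using ((tendsto_rpow_nhdsGT_zero hs).mul (tendsto_green_zero hs hβ hf)).add
        (((tendsto_rpow_nhdsGT_zero (by linarith : 0 < 2 * s)).sub_const 1).const_mul c)
    have := tendsto_nhds_unique ((h0 hsκ).congr' ?_) hlim
    · exact hne (by linarith)
    · filter_upwards [Ioo_mem_nhdsGT (zero_lt_one' ℝ)] with y hy
      have e1 : y ^ (2 * s) = y ^ s * y ^ s := by rw [← Real.rpow_add hy.1]; ring_nf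
      have e2 : y ^ s * y ^ (-s) = 1 := by rw [← Real.rpow_add hy.1]; simp
      rw [hc y hy, e1]
      linear_combination (-c) * e2
  -- If `c ≠ 0`, solving the formula for `x ^ (-s)` puts this function in `L²_β`, which requires `s
  -- < (1 + β) / 2`.
  · have hm : MemLp (fun x : ℝ => x ^ (-s)) 2 (weightedMeasure β) := by
      have h2 := ((memLp_rpow_iff.2 (neg_one_lt_add_two_mul hs hβ)).sub
        ((hu.2.2.1.sub (memLp_green hs hβ hf)).const_mul c⁻¹))
      refine (memLp_congr_ae (ae_weightedMeasure_of_forall fun y hy => ?_)).1 h2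
      simp only [Pi.sub_apply]
      rw [hc y hy]
      field_simp
      ring
    have := memLp_rpow_iff.1 hm
    linarith

/-! ### The fourth order operator -/

theorem EqOn.deriv_Ioo {u v : ℝ → ℝ} (h : EqOn u v (Ioo 0 1)) :
    EqOn (deriv u) (deriv v) (Ioo 0 1) :=
  h.deriv isOpen_Ioo

theorem opA_congr {α β μ : ℝ} {u v : ℝ → ℝ} (h : EqOn u v (Ioo 0 1)) :
    EqOn (opA α β μ u) (opA α β μ v) (Ioo 0 1) := by
  intro x hx
  have h1 : EqOn (fun y => y ^ α * deriv u y) (fun y => y ^ α * deriv v y) (Ioo 0 1) :=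
    fun y hy => by simp only [EqOn.deriv_Ioo h hy]
  rw [opA, opA, EqOn.deriv_Ioo h1 hx, EqOn.deriv_Ioo h hx, h hx]

theorem Dmax_congr {α β μ : ℝ} {u v : ℝ → ℝ} (h : EqOn u v (Ioo 0 1)) (hu : u ∈ Dmax α β μ) :
    v ∈ Dmax α β μ :=
  ⟨hu.1.congr h, hu.2.1.congr fun x hx => by simp only [EqOn.deriv_Ioo h hx],
    (memLp_congr_ae (ae_weightedMeasure_of_forall h)).1 hu.2.2.1,
    (memLp_congr_ae (ae_weightedMeasure_of_forall (opA_congr h))).1 hu.2.2.2⟩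

theorem iteratedDeriv_succ_eq {n : ℕ} {u w : ℝ → ℝ} {w' x : ℝ}
    (h : EqOn (iteratedDeriv n u) w (Ioo 0 1)) (hx : x ∈ Ioo (0 : ℝ) 1) (hw : HasDerivAt w w' x) :
    iteratedDeriv (n + 1) u x = w' := by
  rw [iteratedDeriv_succ, EqOn.deriv_Ioo h hx, hw.deriv]

/-- The expanded form of `𝒜²` at a point, in terms of `v = 𝒜 u`. -/
theorem opASq_eq {α β μ x v₂ : ℝ} {u u₁ v v₁ : ℝ → ℝ} (hαβ : α + β = 1) (hx : x ∈ Ioo (0 : ℝ) 1)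
    (hu : ∀ y ∈ Ioo (0 : ℝ) 1, HasDerivAt u (u₁ y) y)
    (hu₁ : ∀ y ∈ Ioo (0 : ℝ) 1,
      HasDerivAt u₁ (-(y ^ (-α) * v y + u₁ y / y + μ * u y / y ^ 2)) y)
    (hv : ∀ y ∈ Ioo (0 : ℝ) 1, HasDerivAt v (v₁ y) y) (hv₁ : HasDerivAt v₁ v₂ x) :
    opASq α β μ u x = -(x ^ (-β) * (v₁ x + x * v₂ + μ * v x / x)) := by
  -- The second derivative comes from solving `𝒜 u = v` for it, and `u₃` from differentiating once
  -- more; the fourth derivative then exists wherever `v₁` is differentiable.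
  set u₂ : ℝ → ℝ := fun y => -(y ^ (-α) * v y + u₁ y / y + μ * u y / y ^ 2) with hu₂
  set u₃ : ℝ → ℝ := fun y => -(-α * (y ^ (-α) / y) * v y + y ^ (-α) * v₁ y
    + (u₂ y / y - u₁ y / y ^ 2) + (μ * u₁ y / y ^ 2 - 2 * μ * u y / y ^ 3)) with hu₃
  have hpow : ∀ y ∈ Ioo (0 : ℝ) 1, HasDerivAt (fun y : ℝ => y ^ (-α)) (-α * (y ^ (-α) / y)) y :=
    fun y hy => (Real.hasDerivAt_rpow_const (p := -α) (Or.inl hy.1.ne')).congr_deriv (by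
      rw [Real.rpow_sub hy.1, Real.rpow_one])
  have h2 : ∀ y ∈ Ioo (0 : ℝ) 1, HasDerivAt u₂ (u₃ y) y := fun y hy => by
    have hy0 := hy.1.ne'
    refine ((((hpow y hy).mul (hv y hy)).add ((hu₁ y hy).div (hasDerivAt_id y) hy0)).add
      (((hu y hy).const_mul μ).div (hasDerivAt_pow 2 y) (pow_ne_zero 2 hy0))).neg.congr_deriv ?_
    simp only [hu₃, hu₂, id]
    field_simp
    push_cast
    ring
  have h3 : HasDerivAt u₃ (-(-α * (-α - 1) * (x ^ (-α) / x ^ 2) * v x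
      - 2 * α * (x ^ (-α) / x) * v₁ x + x ^ (-α) * v₂
      + (u₃ x / x - 2 * u₂ x / x ^ 2 + 2 * u₁ x / x ^ 3)
      + (μ * u₂ x / x ^ 2 - 4 * μ * u₁ x / x ^ 3 + 6 * μ * u x / x ^ 4))) x := by
    have hx0 := hx.1.ne'
    refine (((((((hpow x hx).div (hasDerivAt_id x) hx0).const_mul (-α)).mul (hv x hx)).add
      ((hpow x hx).mul hv₁)).add (((h2 x hx).div (hasDerivAt_id x) hx0).sub
      ((hu₁ x hx).div (hasDerivAt_pow 2 x) (pow_ne_zero 2 hx0)))).add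
      ((((hu₁ x hx).const_mul μ).div (hasDerivAt_pow 2 x) (pow_ne_zero 2 hx0)).sub
      (((hu x hx).const_mul (2 * μ)).div (hasDerivAt_pow 3 x)
        (pow_ne_zero 3 hx0)))).neg.congr_deriv ?_
    have e2 : -(x ^ (-α) * v x + u₁ x / x + μ * u x / x ^ 2) = u₂ x := rfl
    simp only [Pi.div_apply, id, e2]
    push_cast
    field_simp
    ring
  have i1 : EqOn (iteratedDeriv 1 u) u₁ (Ioo 0 1) := fun y hy => by
    rw [iteratedDeriv_one, (hu y hy).deriv]
  have i2 : EqOn (iteratedDeriv 2 u) u₂ (Ioo 0 1) := fun y hy =>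
    iteratedDeriv_succ_eq i1 hy (hu₁ y hy)
  have i3 : EqOn (iteratedDeriv 3 u) u₃ (Ioo 0 1) := fun y hy =>
    iteratedDeriv_succ_eq i2 hy (h2 y hy)
  have i4 := iteratedDeriv_succ_eq i3 hx h3
  have hx0 : 0 < x := hx.1
  have eβ : β = 1 - α := by linarith
  have p1 : x ^ (2 * α) = (x ^ α) ^ 2 := by
    rw [two_mul, Real.rpow_add hx0, sq]
  have p2 : x ^ (-α) = (x ^ α)⁻¹ := Real.rpow_neg hx0.le α
  rw [opASq, i4, i3 hx, i2 hx, (hu x hx).deriv, eβ, Real.rpow_sub hx0, Real.rpow_sub hx0 _ 2,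
    Real.rpow_sub hx0 _ 3, Real.rpow_sub hx0 4, neg_sub, Real.rpow_sub hx0 α 1, p1,
    Real.rpow_one, Real.rpow_two, show (3 : ℝ) = ((3 : ℕ) : ℝ) by norm_num, Real.rpow_natCast,
    show (4 : ℝ) = ((4 : ℕ) : ℝ) by norm_num, Real.rpow_natCast]
  have hne : x ^ α ≠ 0 := (Real.rpow_pos_of_pos hx0 α).ne'
  simp only [hu₃, hu₂, p2]
  push_cast
  field_simp
  ring

/-- On the domain of the square, `𝒜 u` is itself locally absolutely continuous, so the equation for
the flux of `u` holds at every point. -/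
theorem hasDerivAt_flux_of_mem_Dmax {α β μ : ℝ} {u : ℝ → ℝ} (hαβ : α + β = 1)
    (hu : u ∈ Dmax α β μ) (hc : ContinuousOn (opA α β μ u) (Ioo 0 1)) {x : ℝ}
    (hx : x ∈ Ioo (0 : ℝ) 1) :
    HasDerivAt (fun y => y * deriv u y) (-(x ^ β * opA α β μ u x + μ * u x / x)) x := by
  refine hu.2.1.hasDerivAt_of_ae (h := fun x => -(x ^ β * opA α β μ u x + μ * u x / x)) ?_ ?_ hx
  · exact (((ACloc.rpow β).continuousOn.mul hc).add
      ((continuousOn_const.mul hu.1.continuousOn).div continuousOn_id fun y hy => hy.1.ne')).neg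
  · filter_upwards [hu.2.1.ae_differentiableAt, ae_restrict_mem measurableSet_Ioo] with y hy hy1
    refine hy.hasDerivAt.congr_deriv ?_
    have e : y ^ β * y ^ (-β) = 1 := by rw [← Real.rpow_add hy1.1]; simp
    rw [opA_eq_of_hasDerivAt hαβ hy1.1 hy.hasDerivAt]
    linear_combination (-(deriv (fun y => y * deriv u y) y + μ * u y / y)) * e

theorem hasDerivAt_deriv_of_mem_Dmax {α β μ : ℝ} {u : ℝ → ℝ} (hαβ : α + β = 1)
    (hu : u ∈ Dmax α β μ) (hc : ContinuousOn (opA α β μ u) (Ioo 0 1)) {x : ℝ}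
    (hx : x ∈ Ioo (0 : ℝ) 1) :
    HasDerivAt (deriv u) (-(x ^ (-α) * opA α β μ u x + deriv u x / x + μ * u x / x ^ 2)) x := by
  have h1 := (hasDerivAt_flux_of_mem_Dmax hαβ hu hc hx).div (hasDerivAt_id x) hx.1.ne'
  refine (h1.congr_of_eventuallyEq ?_).congr_deriv ?_
  · filter_upwards [isOpen_Ioo.mem_nhds hx] with y hy
    have := hy.1.ne'
    simp [this]
  · have hx0 := hx.1.ne'
    have e : x ^ β = x * x ^ (-α) := by
      rw [show β = 1 + -α by linarith, Real.rpow_add hx.1, Real.rpow_one]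
    rw [e]
    simp only [id]
    field_simp
    ring

/-- The only exceptional points are those where the flux of `𝒜 u` is not differentiable; elsewhere
`u` has four classical derivatives. -/
theorem ae_opASq_eq {α β μ : ℝ} {u : ℝ → ℝ} (hαβ : α + β = 1) (hu : u ∈ Dmax α β μ)
    (hv : opA α β μ u ∈ Dmax α β μ) :
    ∀ᵐ x ∂(volume.restrict (Ioo (0 : ℝ) 1)),
      opASq α β μ u x = opA α β μ (opA α β μ u) x := by
  filter_upwards [hv.2.1.ae_differentiableAt, ae_restrict_mem measurableSet_Ioo] with x hx hx01
  have hx0 := hx01.1.ne'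
  have hd : DifferentiableAt ℝ (deriv (opA α β μ u)) x := by
    refine (hx.div differentiableAt_id hx0).congr_of_eventuallyEq ?_
    filter_upwards [isOpen_Ioo.mem_nhds hx01] with y hy
    have := hy.1.ne'
    simp [this]
  rw [opASq_eq hαβ hx01 (fun y hy => hasDerivAt_of_mem_Dmax hu hy)
    (fun y hy => hasDerivAt_deriv_of_mem_Dmax hαβ hu hv.1.continuousOn hy)
    (fun y hy => hasDerivAt_of_mem_Dmax hv hy) hd.hasDerivAt,
    opA_eq_of_hasDerivAt hαβ hx01.1 ((hasDerivAt_id x).mul hd.hasDerivAt)]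
  simp

theorem tendsto_id_nhdsLT_one : Tendsto (fun x : ℝ => x) (𝓝[<] 1) (𝓝 1) :=
  tendsto_id.mono_left nhdsWithin_le_nhds

/-- Under `u(1) = 0`, the condition `(x u_x)_x(1) = 0` says that `𝒜 u` vanishes at `1`. -/
theorem tendsto_deriv_flux_iff {α β μ : ℝ} {u : ℝ → ℝ} (hαβ : α + β = 1) (hu : u ∈ Dmax α β μ)
    (hc : ContinuousOn (opA α β μ u) (Ioo 0 1)) (h1 : Tendsto u (𝓝[<] 1) (𝓝 0)) :
    Tendsto (deriv fun x => x * deriv u x) (𝓝[<] 1) (𝓝 0) ↔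
      Tendsto (opA α β μ u) (𝓝[<] 1) (𝓝 0) := by
  have hq : Tendsto (fun x => μ * u x / x) (𝓝[<] 1) (𝓝 0) := by
    simpa using! (h1.const_mul μ).div tendsto_id_nhdsLT_one one_ne_zero
  constructor
  · intro h
    have h2 : Tendsto (fun x => -(x ^ (-β) * (deriv (fun x => x * deriv u x) x + μ * u x / x)))
        (𝓝[<] 1) (𝓝 0) := by
      simpa using! ((tendsto_rpow_nhdsLT_one (-β)).mul (h.add hq)).neg
    refine h2.congr' ?_
    filter_upwards [Ioo_mem_nhdsLT (zero_lt_one' ℝ)] with x hx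
    rw [opA_eq_of_hasDerivAt hαβ hx.1
      (hasDerivAt_flux_of_mem_Dmax hαβ hu hc hx).differentiableAt.hasDerivAt]
  · intro h
    have h2 : Tendsto (fun x => -(x ^ β * opA α β μ u x + μ * u x / x)) (𝓝[<] 1) (𝓝 0) := by
      simpa using! (((tendsto_rpow_nhdsLT_one β).mul h).add hq).neg
    refine h2.congr' ?_
    filter_upwards [Ioo_mem_nhdsLT (zero_lt_one' ℝ)] with x hx
    exact (hasDerivAt_flux_of_mem_Dmax hαβ hu hc hx).deriv.symm

theorem sqrt_neg_neg_sq {s : ℝ} (hs : 0 < s) : √(-(-s ^ 2)) = s := by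
  rw [neg_neg, Real.sqrt_sq hs.le]

theorem kappa_eq {α β : ℝ} (hαβ : α + β = 1) : kappa α = (1 + β) / 2 := by
  rw [kappa]
  linarith

/-- The boundary conditions on `u` are the second order ones for both `u` and `𝒜 u`, so `u = G (𝒜
u)` and `𝒜 u = G (𝒜 (𝒜 u))`: the domain is contained in the range of `G²`. -/
theorem eq_green_of_mem_domASq {α s β : ℝ} (hαβ : α + β = 1) (hs : 0 < s) (hβ : -1 < β)
    {u : ℝ → ℝ} (hu : u ∈ domASq α β (-s ^ 2)) :
    EqOn u (green s β (opA α β (-s ^ 2) u)) (Ioo 0 1) ∧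
      EqOn (opA α β (-s ^ 2) u) (green s β (opA α β (-s ^ 2) (opA α β (-s ^ 2) u))) (Ioo 0 1) := by
  obtain ⟨h1, h2, h3, h4, h5⟩ := hu
  rw [sqrt_neg_neg_sq hs, kappa_eq hαβ] at h3
  exact ⟨fun x hx => eq_green_opA hαβ hs hβ h1 h5 (fun h => (h3 h).1) hx,
    fun x hx => eq_green_opA hαβ hs hβ h2
      ((tendsto_deriv_flux_iff hαβ h1 h2.1.continuousOn h5).1 h4) (fun h => (h3 h).2) hx⟩

theorem opA_green_of_continuousOn {α s β : ℝ} (hαβ : α + β = 1) (h : -1 < β + 2 * s) {f : ℝ → ℝ}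
    (hf : MemLp f 2 (weightedMeasure β)) (hc : ContinuousOn f (Ioo 0 1)) :
    EqOn (opA α β (-s ^ 2) (green s β f)) f (Ioo 0 1) :=
  fun _ hx => opA_green hαβ h hf hx (hasDerivAt_prim h hf hc hx)

/-- The opposite inclusion. Only equality on `(0, 1)` is asked, so that it also applies to the
explicit eigenfunctions. -/
theorem mem_domASq_of_eqOn_green {α s β : ℝ} (hαβ : α + β = 1) (hs : 0 < s) (hβ : -1 < β)
    {u v f : ℝ → ℝ} (hv : EqOn v (green s β f) (Ioo 0 1)) (hu : EqOn u (green s β v) (Ioo 0 1))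
    (hf : MemLp f 2 (weightedMeasure β)) : u ∈ domASq α β (-s ^ 2) := by
  have h := neg_one_lt_add_two_mul hs hβ
  have hvD : v ∈ Dmax α β (-s ^ 2) := Dmax_congr hv.symm (green_mem_Dmax hαβ hs hβ hf)
  have hvm : MemLp v 2 (weightedMeasure β) := hvD.2.2.1
  have huD : u ∈ Dmax α β (-s ^ 2) := Dmax_congr hu.symm (green_mem_Dmax hαβ hs hβ hvm)
  have huv : EqOn (opA α β (-s ^ 2) u) v (Ioo 0 1) := fun x hx => by
    rw [opA_congr hu hx, opA_green_of_continuousOn hαβ h hvm hvD.1.continuousOn hx]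
  have h0 : ∀ {w g : ℝ → ℝ}, EqOn w (green s β g) (Ioo 0 1) → MemLp g 2 (weightedMeasure β) →
      Tendsto (fun x => x ^ s * w x) (𝓝[>] 0) (𝓝 0) := fun {w g} hw hg => by
    have h1 : Tendsto (fun x => x ^ s * green s β g x) (𝓝[>] 0) (𝓝 0) := by
      simpa using (tendsto_rpow_nhdsGT_zero hs).mul (tendsto_green_zero hs hβ hg)
    refine h1.congr' ?_
    filter_upwards [Ioo_mem_nhdsGT (zero_lt_one' ℝ)] with x hx
    rw [hw hx]
  have h1 : ∀ {w g : ℝ → ℝ}, EqOn w (green s β g) (Ioo 0 1) → MemLp g 2 (weightedMeasure β) →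
      Tendsto w (𝓝[<] 1) (𝓝 0) := fun {w g} hw hg => by
    refine (tendsto_green_one h hg).congr' ?_
    filter_upwards [Ioo_mem_nhdsLT (zero_lt_one' ℝ)] with x hx
    rw [hw hx]
  have hAu := huv.trans hv
  refine ⟨huD, Dmax_congr huv.symm hvD, fun _ => ?_, ?_, h1 hu hvm⟩
  · rw [sqrt_neg_neg_sq hs]
    exact ⟨h0 hu hvm, h0 hAu hf⟩
  · exact (tendsto_deriv_flux_iff hαβ huD (hvD.1.continuousOn.congr huv) (h1 hu hvm)).2 (h1 hAu hf)

/-! ### The self-adjoint realization -/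

/-- The inverse of `-𝒜²`. -/
def negGreenSq {s β : ℝ} (hβ : -1 < β) (h : -1 < β + 2 * s) : L2w β →L[ℝ] L2w β :=
  -((greenOp hβ h).comp (greenOp hβ h))

theorem negGreenSq_apply {s β : ℝ} (hβ : -1 < β) (h : -1 < β + 2 * s) (f : L2w β) :
    negGreenSq hβ h f = -greenOp hβ h (greenOp hβ h f) :=
  rfl

theorem injective_negGreenSq {s β : ℝ} (hβ : -1 < β) (h : -1 < β + 2 * s) :
    Function.Injective (negGreenSq hβ h) := fun f g hfg => by
  rw [negGreenSq_apply, negGreenSq_apply, neg_inj] at hfg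
  exact injective_greenOp hβ h (injective_greenOp hβ h hfg)

theorem inner_greenOp_comm {s β : ℝ} (hβ : -1 < β) (h : -1 < β + 2 * s) (f g : L2w β) :
    inner ℝ (greenOp hβ h f) g = inner ℝ f (greenOp hβ h g) :=
  isSymmetric_greenOp hβ h f g

theorem isSymmetric_negGreenSq {s β : ℝ} (hβ : -1 < β) (h : -1 < β + 2 * s) :
    (negGreenSq hβ h : L2w β →ₗ[ℝ] L2w β).IsSymmetric := fun f g => by
  change inner ℝ (negGreenSq hβ h f) g = inner ℝ f (negGreenSq hβ h g)
  rw [negGreenSq_apply, negGreenSq_apply, inner_neg_left, inner_neg_right, inner_greenOp_comm,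
    inner_greenOp_comm]

/-- The self-adjoint operator `-𝒜²`. -/
def negASq {s β : ℝ} (hβ : -1 < β) (h : -1 < β + 2 * s) : L2w β →ₗ.[ℝ] L2w β :=
  rangeInverse (negGreenSq hβ h) (injective_negGreenSq hβ h)

/-- With `f = -G (G g)`, the inner product equals `-‖G g‖²`, and `G g = 0` would give `f = 0`. -/
theorem inner_negASq_lt_zero {s β : ℝ} (hβ : -1 < β) (h : -1 < β + 2 * s)
    (f : (negASq hβ h).domain) (hf : f ≠ 0) : inner ℝ (negASq hβ h f) (f : L2w β) < 0 := by
  have h1 : negGreenSq hβ h (negASq hβ h f) = f := apply_rangeInverse _ _ f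
  set g := negASq hβ h f with hg
  rw [← h1, negGreenSq_apply, inner_neg_right, ← inner_greenOp_comm, real_inner_self_eq_norm_sq,
    neg_lt_zero]
  refine pow_pos (norm_pos_iff.2 fun h0 => hf ?_) 2
  rw [negGreenSq_apply, h0, map_zero, neg_zero] at h1
  exact Subtype.ext h1.symm

theorem eq_negGreenSq_of_mem_domASq {α s β : ℝ} (hαβ : α + β = 1) (hs : 0 < s) (hβ : -1 < β)
    (h : -1 < β + 2 * s) {u : ℝ → ℝ} (hu : u ∈ domASq α β (-s ^ 2)) {f : L2w β}
    (hfu : f =ᵐ[weightedMeasure β] u) :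
    ∃ g : L2w β, negGreenSq hβ h g = f ∧
      g =ᵐ[weightedMeasure β] fun x => -opASq α β (-s ^ 2) u x := by
  obtain ⟨e1, e2⟩ := eq_green_of_mem_domASq hαβ hs hβ hu
  have hw : MemLp (opA α β (-s ^ 2) (opA α β (-s ^ 2) u)) 2 (weightedMeasure β) := hu.2.1.2.2.2
  refine ⟨-hw.toLp _, ?_, ?_⟩
  · rw [negGreenSq_apply, map_neg, map_neg, neg_neg]
    refine Lp.ext ?_
    have k1 := (greenOp_coeFn hs hβ h hw.coeFn_toLp).trans
      (ae_weightedMeasure_of_forall e2.symm)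
    exact ((greenOp_coeFn hs hβ h k1).trans (ae_weightedMeasure_of_forall e1.symm)).trans hfu.symm
  · filter_upwards [Lp.coeFn_neg (hw.toLp _), hw.coeFn_toLp,
      ae_weightedMeasure_iff.2 (ae_opASq_eq hαβ hu.1 hu.2.1)] with x h1 h2 h3
    rw [h1, Pi.neg_apply, h2, h3]

theorem isNegASq_negASq {α s β : ℝ} (hαβ : α + β = 1) (hs : 0 < s) (hβ : -1 < β)
    (h : -1 < β + 2 * s) : IsNegASq α β (-s ^ 2) (negASq hβ h) := by
  refine ⟨fun f => ⟨fun hf => ?_, ?_⟩, fun f u hu hfu => ?_⟩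
  · obtain ⟨g, hg⟩ := (mem_rangeInverse_domain _ _).1 hf
    have hm := Lp.memLp (-g)
    refine ⟨green s β (green s β (-g : L2w β)), mem_domASq_of_eqOn_green hαβ hs hβ (fun _ _ => rfl)
      (fun _ _ => rfl) hm, ?_⟩
    rw [← hg, negGreenSq_apply, ← map_neg, ← map_neg]
    exact greenOp_coeFn hs hβ h (greenOp_coeFn hs hβ h (ae_eq_refl _))
  · rintro ⟨u, hu, hfu⟩
    obtain ⟨g, hg, -⟩ := eq_negGreenSq_of_mem_domASq hαβ hs hβ h hu hfu
    exact (mem_rangeInverse_domain _ _).2 ⟨g, hg⟩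
  · obtain ⟨g, hg, hgu⟩ := eq_negGreenSq_of_mem_domASq hαβ hs hβ h hu hfu
    have : negASq hβ h f = g := rangeInverse_eq _ _ f hg
    rw [this]
    exact hgu

/-! ### Power series with factorially decaying coefficients -/

/-- The sum of the power series with coefficients `c`. -/
def powSum (c : ℕ → ℝ) (x : ℝ) : ℝ := ∑' m : ℕ, c m * x ^ m

/-- The coefficients of the derivative. -/
def derivCoeff (c : ℕ → ℝ) (m : ℕ) : ℝ := (m + 1) * c (m + 1)

theorem summable_powSum {c : ℕ → ℝ} {C : ℝ} (hc : ∀ m, |c m| ≤ C / m.factorial) (x : ℝ) :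
    Summable fun m => c m * x ^ m := by
  refine Summable.of_norm_bounded ((Real.summable_pow_div_factorial |x|).mul_left C) fun m => ?_
  rw [Real.norm_eq_abs, abs_mul, abs_pow, ← mul_div_assoc, mul_div_right_comm]
  exact mul_le_mul_of_nonneg_right (hc m) (by positivity)

/-- The factorial bound survives differentiation with the same constant, so it can be iterated for
the second derivative. -/
theorem abs_derivCoeff_le {c : ℕ → ℝ} {C : ℝ} (hc : ∀ m, |c m| ≤ C / m.factorial) (m : ℕ) :
    |derivCoeff c m| ≤ C / m.factorial := by
  have hm : (0 : ℝ) < m + 1 := by positivity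
  rw [derivCoeff, abs_mul, abs_of_pos hm]
  refine (mul_le_mul_of_nonneg_left (hc (m + 1)) hm.le).trans (le_of_eq ?_)
  rw [Nat.factorial_succ]
  push_cast
  field_simp

theorem hasDerivAt_powSum {c : ℕ → ℝ} {C : ℝ} (hc : ∀ m, |c m| ≤ C / m.factorial) (x : ℝ) :
    HasDerivAt (powSum c) (powSum (derivCoeff c) x) x := by
  set R := |x| + 1 with hR
  have hxR : x ∈ Metric.ball (0 : ℝ) R := by simp [hR]
  have hsum : Summable fun m : ℕ => |c m| * (m * R ^ (m - 1)) := by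
    rw [← summable_nat_add_iff 1]
    refine (summable_powSum (c := fun m => |derivCoeff c m|) (C := C) (fun m => ?_) R).congr
      fun m => ?_
    · rw [abs_abs]
      exact abs_derivCoeff_le hc m
    · have hm : (0 : ℝ) < m + 1 := by positivity
      simp only [derivCoeff, abs_mul, abs_of_pos hm, Nat.add_sub_cancel]
      push_cast
      ring
  have hd := hasDerivAt_tsum_of_isPreconnected (g := fun m y => c m * y ^ m)
    (g' := fun m y => c m * (m * y ^ (m - 1))) hsum Metric.isOpen_ball
    (convex_ball (0 : ℝ) R).isPreconnected (fun m y _ => (hasDerivAt_pow m y).const_mul (c m))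
    (fun m y hy => ?_) hxR (summable_powSum hc x) hxR
  · refine hd.congr_deriv ?_
    have hs : Summable fun m : ℕ => c m * (m * x ^ (m - 1)) := by
      rw [← summable_nat_add_iff 1]
      refine (summable_powSum (abs_derivCoeff_le hc) x).congr fun m => ?_
      simp only [derivCoeff, Nat.add_sub_cancel]
      push_cast
      ring
    rw [hs.tsum_eq_zero_add, powSum]
    simp only [Nat.cast_zero, zero_mul, mul_zero, zero_add, derivCoeff, Nat.add_sub_cancel]
    refine tsum_congr fun m => ?_
    push_cast
    ring
  · rw [mem_ball_zero_iff, Real.norm_eq_abs] at hy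
    rw [Real.norm_eq_abs, abs_mul, abs_mul, abs_pow, Nat.abs_cast]
    gcongr

/-- The recursion for the coefficients turns into a differential equation. -/
theorem powSum_ode {c : ℕ → ℝ} {C ν : ℝ} (hc : ∀ m, |c m| ≤ C / m.factorial)
    (hrec : ∀ m : ℕ, (m + 1) * (m + 1 + ν) * c (m + 1) = -c m) (x : ℝ) :
    x * powSum (derivCoeff (derivCoeff c)) x + (ν + 1) * powSum (derivCoeff c) x + powSum c x
      = 0 := by
  have hc1 := abs_derivCoeff_le hc
  have s0 := summable_powSum hc x
  have s1 := summable_powSum hc1 x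
  have s2 := summable_powSum (abs_derivCoeff_le hc1) x
  have hshift : ∀ m : ℕ, x * (derivCoeff (derivCoeff c) m * x ^ m)
      = ((m + 1 : ℕ) : ℝ) * derivCoeff c (m + 1) * x ^ (m + 1) := fun m => by
    simp only [derivCoeff]
    push_cast
    ring
  have s3 : Summable fun m : ℕ => (m : ℝ) * derivCoeff c m * x ^ m := by
    rw [← summable_nat_add_iff 1]
    exact (s2.mul_left x).congr hshift
  have e3 : x * powSum (derivCoeff (derivCoeff c)) x
      = ∑' m : ℕ, (m : ℝ) * derivCoeff c m * x ^ m := by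
    rw [s3.tsum_eq_zero_add, powSum, ← tsum_mul_left]
    simp [hshift]
  rw [e3, powSum, powSum, ← tsum_mul_left, ← s3.tsum_add (s1.mul_left _),
    ← (s3.add (s1.mul_left _)).tsum_add s0]
  convert tsum_zero with m
  have := hrec m
  simp only [derivCoeff]
  linear_combination x ^ m * this

/-! ### Bessel functions -/

/-- The coefficients of the entire function `z ↦ z ^ (-ν / 2) * J_ν (2 √z)`. -/
def besselCoeff (ν : ℝ) (m : ℕ) : ℝ := (-1) ^ m / ((m.factorial : ℝ) * Real.Gamma (m + ν + 1))

theorem besselCoeff_rec {ν : ℝ} (hν : 0 < ν) (m : ℕ) :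
    (m + 1) * (m + 1 + ν) * besselCoeff ν (m + 1) = -besselCoeff ν m := by
  have h1 : (0 : ℝ) < m + ν + 1 := by positivity
  have h2 : Real.Gamma (((m + 1 : ℕ) : ℝ) + ν + 1) = (m + ν + 1) * Real.Gamma (m + ν + 1) := by
    rw [← Real.Gamma_add_one h1.ne']
    push_cast
    ring_nf
  have h3 := (Real.Gamma_pos_of_pos h1).ne'
  have h4 : ((m : ℝ) + 1 + ν) ≠ 0 := by positivity
  have h5 : ((m : ℝ) + ν + 1) ≠ 0 := h1.ne'
  rw [besselCoeff, besselCoeff, h2, Nat.factorial_succ, pow_succ]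
  push_cast
  field_simp
  ring

theorem abs_besselCoeff_le {ν : ℝ} (hν : 0 < ν) (m : ℕ) :
    |besselCoeff ν m| ≤ |besselCoeff ν 0| / m.factorial := by
  induction m with
  | zero => simp
  | succ m ih =>
    have hm : (0 : ℝ) < m + 1 := by positivity
    have h1 : (m + 1) * |besselCoeff ν (m + 1)| ≤ |besselCoeff ν m| := by
      have h2 := congrArg abs (besselCoeff_rec hν m)
      rw [abs_neg, abs_mul, abs_mul, abs_of_pos hm,
        abs_of_pos (by positivity : (0 : ℝ) < m + 1 + ν)] at h2
      rw [← h2]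
      refine mul_le_mul_of_nonneg_right ?_ (abs_nonneg _)
      have : (0 : ℝ) ≤ m := m.cast_nonneg
      exact le_mul_of_one_le_right hm.le (by linarith)
    rw [Nat.factorial_succ]
    push_cast
    rw [mul_comm ((m : ℝ) + 1), ← div_div, le_div_iff₀ hm, mul_comm]
    exact h1.trans ih

/-- This splits `J_ν` into a real power and an entire function of `y ^ 2 / 4`, so that termwise
differentiation is needed for the latter only. -/
theorem besselJ_eq {ν y : ℝ} (hy : 0 < y) :
    besselJ ν y = (y / 2) ^ ν * powSum (besselCoeff ν) (y ^ 2 / 4) := by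
  rw [besselJ, powSum, ← tsum_mul_left]
  refine tsum_congr fun m => ?_
  have h2 : (y / 2) ^ (2 * (m : ℝ)) = (y ^ 2 / 4) ^ m := by
    rw [show (2 * (m : ℝ)) = ((2 * m : ℕ) : ℝ) by push_cast; ring, Real.rpow_natCast, pow_mul]
    congr 1
    ring
  rw [Real.rpow_add (by positivity), h2, besselCoeff]
  ring

/-- The function `y * J_ν'(y)`. -/
def besselE (ν y : ℝ) : ℝ := y * deriv (besselJ ν) y

theorem hasDerivAt_besselJ_aux {ν : ℝ} (hν : 0 < ν) {y : ℝ} (hy : 0 < y) :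
    HasDerivAt (besselJ ν) ((y / 2) ^ ν * (ν * powSum (besselCoeff ν) (y ^ 2 / 4)
      + 2 * (y ^ 2 / 4) * powSum (derivCoeff (besselCoeff ν)) (y ^ 2 / 4)) / y) y := by
  have h1 : HasDerivAt (fun y : ℝ => (y / 2) ^ ν) (1 / 2 * ν * (y / 2) ^ (ν - 1)) y :=
    ((hasDerivAt_id y).div_const 2).rpow_const (Or.inl (by simp [hy.ne']))
  have h2 : HasDerivAt (fun y : ℝ => y ^ 2 / 4) (y / 2) y :=
    ((hasDerivAt_pow 2 y).div_const 4).congr_deriv (by push_cast; ring)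
  have h3 := (hasDerivAt_powSum (abs_besselCoeff_le hν) (y ^ 2 / 4)).comp y h2
  refine ((h1.mul h3).congr_of_eventuallyEq ?_).congr_deriv ?_
  · filter_upwards [lt_mem_nhds hy] with z hz using besselJ_eq hz
  · rw [Real.rpow_sub (by positivity), Real.rpow_one]
    simp only [Function.comp]
    field_simp
    ring

theorem besselE_eq {ν : ℝ} (hν : 0 < ν) {y : ℝ} (hy : 0 < y) :
    besselE ν y = (y / 2) ^ ν * (ν * powSum (besselCoeff ν) (y ^ 2 / 4)
      + 2 * (y ^ 2 / 4) * powSum (derivCoeff (besselCoeff ν)) (y ^ 2 / 4)) := by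
  rw [besselE, (hasDerivAt_besselJ_aux hν hy).deriv]
  field_simp

theorem hasDerivAt_besselJ {ν : ℝ} (hν : 0 < ν) {y : ℝ} (hy : 0 < y) :
    HasDerivAt (besselJ ν) (besselE ν y / y) y := by
  rw [besselE_eq hν hy]
  exact hasDerivAt_besselJ_aux hν hy

/-- Bessel's differential equation. -/
theorem hasDerivAt_besselE {ν : ℝ} (hν : 0 < ν) {y : ℝ} (hy : 0 < y) :
    HasDerivAt (besselE ν) ((ν ^ 2 / y - y) * besselJ ν y) y := by
  have hc := abs_besselCoeff_le hν
  have h1 : HasDerivAt (fun y : ℝ => (y / 2) ^ ν) (1 / 2 * ν * (y / 2) ^ (ν - 1)) y :=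
    ((hasDerivAt_id y).div_const 2).rpow_const (Or.inl (by simp [hy.ne']))
  have h2 : HasDerivAt (fun y : ℝ => y ^ 2 / 4) (y / 2) y :=
    ((hasDerivAt_pow 2 y).div_const 4).congr_deriv (by push_cast; ring)
  have h3 := (hasDerivAt_powSum hc (y ^ 2 / 4)).comp y h2
  have h4 := (hasDerivAt_powSum (abs_derivCoeff_le hc) (y ^ 2 / 4)).comp y h2
  have hode := powSum_ode hc (besselCoeff_rec hν) (y ^ 2 / 4)
  refine ((h1.mul ((h3.const_mul ν).add ((h2.const_mul 2).mul h4))).congr_of_eventuallyEq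
    ?_).congr_deriv ?_
  · filter_upwards [lt_mem_nhds hy] with z hz using besselE_eq hν hz
  · rw [Real.rpow_sub (by positivity), Real.rpow_one, besselJ_eq hy]
    simp only [Pi.add_apply, Pi.mul_apply, Function.comp]
    field_simp
    linear_combination 8 * y ^ 2 * hode

theorem tendsto_besselJ_zero {ν : ℝ} (hν : 0 < ν) : Tendsto (besselJ ν) (𝓝[>] 0) (𝓝 0) := by
  have hg : Continuous (powSum (besselCoeff ν)) := continuous_iff_continuousAt.2 fun x =>
    (hasDerivAt_powSum (abs_besselCoeff_le hν) x).continuousAt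
  have hc : ContinuousAt (fun y : ℝ => (y / 2) ^ ν * powSum (besselCoeff ν) (y ^ 2 / 4)) 0 :=
    ((continuousAt_id.div_const 2).rpow_const (Or.inr hν.le)).mul (by fun_prop)
  have := hc.tendsto
  simp only [zero_div, Real.zero_rpow hν.ne', zero_mul] at this
  refine (this.mono_left nhdsWithin_le_nhds).congr' ?_
  filter_upwards [self_mem_nhdsWithin] with y hy using (besselJ_eq hy).symm

theorem tendsto_besselE_zero {ν : ℝ} (hν : 0 < ν) : Tendsto (besselE ν) (𝓝[>] 0) (𝓝 0) := by
  have hg : Continuous (powSum (besselCoeff ν)) := continuous_iff_continuousAt.2 fun x =>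
    (hasDerivAt_powSum (abs_besselCoeff_le hν) x).continuousAt
  have hg1 : Continuous (powSum (derivCoeff (besselCoeff ν))) :=
    continuous_iff_continuousAt.2 fun x =>
      (hasDerivAt_powSum (abs_derivCoeff_le (abs_besselCoeff_le hν)) x).continuousAt
  have hc : ContinuousAt (fun y : ℝ => (y / 2) ^ ν * (ν * powSum (besselCoeff ν) (y ^ 2 / 4)
      + 2 * (y ^ 2 / 4) * powSum (derivCoeff (besselCoeff ν)) (y ^ 2 / 4))) 0 :=
    ((continuousAt_id.div_const 2).rpow_const (Or.inr hν.le)).mul (by fun_prop)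
  have := hc.tendsto
  simp only [zero_div, Real.zero_rpow hν.ne', zero_mul] at this
  refine (this.mono_left nhdsWithin_le_nhds).congr' ?_
  filter_upwards [self_mem_nhdsWithin] with y hy using (besselE_eq hν hy).symm

/-- The entire factor takes the value `1 / Γ(ν + 1) > 0` at `0`. -/
theorem eventually_besselJ_pos {ν : ℝ} (hν : 0 < ν) : ∀ᶠ y in 𝓝[>] (0 : ℝ), 0 < besselJ ν y := by
  have hg : Continuous (powSum (besselCoeff ν)) := continuous_iff_continuousAt.2 fun x =>
    (hasDerivAt_powSum (abs_besselCoeff_le hν) x).continuousAt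
  have h0 : powSum (besselCoeff ν) ((0 : ℝ) ^ 2 / 4) = besselCoeff ν 0 := by
    rw [powSum, tsum_eq_single 0 fun m hm => by simp [hm]]
    simp
  have hpos : 0 < powSum (besselCoeff ν) ((0 : ℝ) ^ 2 / 4) := by
    rw [h0, besselCoeff]
    have := Real.Gamma_pos_of_pos (by linarith : 0 < ν + 1)
    simpa using this
  have hc : Continuous fun y : ℝ => powSum (besselCoeff ν) (y ^ 2 / 4) := by fun_prop
  filter_upwards [nhdsWithin_le_nhds ((hc.tendsto 0).eventually (lt_mem_nhds hpos)), self_mem_nhdsWithin] with y hy hy0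
  rw [besselJ_eq hy0]
  have : (0 : ℝ) < y := hy0
  positivity

theorem continuousAt_besselJ {ν : ℝ} (hν : 0 < ν) {y : ℝ} (hy : 0 < y) :
    ContinuousAt (besselJ ν) y :=
  (hasDerivAt_besselJ hν hy).continuousAt

/-! ### Solutions of `𝒜 u = q u` -/

theorem memLp_of_tendsto {β l₀ l₁ : ℝ} (hβ : -1 < β) {u : ℝ → ℝ} (hc : ContinuousOn u (Ioo 0 1))
    (h0 : Tendsto u (𝓝[>] 0) (𝓝 l₀)) (h1 : Tendsto u (𝓝[<] 1) (𝓝 l₁)) :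
    MemLp u 2 (weightedMeasure β) := by
  have hext := continuousOn_Icc_extendFrom_Ioo hc h0 h1
  obtain ⟨C, hC⟩ := isCompact_Icc.exists_bound_of_continuousOn hext
  refine memLp_of_continuousOn_of_bound (C := C) hβ hc fun x hx => ?_
  have h2 := hC x (Ioo_subset_Icc_self hx)
  rwa [extendFrom_extends hc x hx] at h2

/-- `u` solves `𝒜 u = q u` on `(0, 1)` with flux `U = x ∂ₓ u`, and both vanish at `0`. -/
structure IsBesselPair (s β q : ℝ) (u U : ℝ → ℝ) : Prop where
  hasDerivAt : ∀ x ∈ Ioo (0 : ℝ) 1, HasDerivAt u (U x / x) x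
  hasDerivAt_flux : ∀ x ∈ Ioo (0 : ℝ) 1, HasDerivAt U ((s ^ 2 / x - q * x ^ β) * u x) x
  tendsto_zero : Tendsto u (𝓝[>] 0) (𝓝 0)
  tendsto_flux_zero : Tendsto U (𝓝[>] 0) (𝓝 0)

namespace IsBesselPair

variable {s β q : ℝ} {u U w W : ℝ → ℝ}

theorem sub_const_mul (hu : IsBesselPair s β q u U) (hw : IsBesselPair s β q w W) (c : ℝ) :
    IsBesselPair s β q (fun x => u x - c * w x) (fun x => U x - c * W x) where
  hasDerivAt x hx := ((hu.hasDerivAt x hx).sub ((hw.hasDerivAt x hx).const_mul c)).congr_deriv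
    (by ring)
  hasDerivAt_flux x hx :=
    ((hu.hasDerivAt_flux x hx).sub ((hw.hasDerivAt_flux x hx).const_mul c)).congr_deriv (by ring)
  tendsto_zero := by simpa using hu.tendsto_zero.sub (hw.tendsto_zero.const_mul c)
  tendsto_flux_zero := by simpa using hu.tendsto_flux_zero.sub (hw.tendsto_flux_zero.const_mul c)

theorem const_mul (hu : IsBesselPair s β q u U) (c : ℝ) :
    IsBesselPair s β q (fun x => c * u x) (fun x => c * U x) where
  hasDerivAt x hx := ((hu.hasDerivAt x hx).const_mul c).congr_deriv (by ring)
  hasDerivAt_flux x hx := ((hu.hasDerivAt_flux x hx).const_mul c).congr_deriv (by ring)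
  tendsto_zero := by simpa using hu.tendsto_zero.const_mul c
  tendsto_flux_zero := by simpa using hu.tendsto_flux_zero.const_mul c

theorem continuousOn (hu : IsBesselPair s β q u U) : ContinuousOn u (Ioo 0 1) :=
  fun x hx => (hu.hasDerivAt x hx).continuousAt.continuousWithinAt

theorem continuousOn_flux (hu : IsBesselPair s β q u U) : ContinuousOn U (Ioo 0 1) :=
  fun x hx => (hu.hasDerivAt_flux x hx).continuousAt.continuousWithinAt

theorem memLp (hu : IsBesselPair s β q u U) (hβ : -1 < β) {l : ℝ}
    (h1 : Tendsto u (𝓝[<] 1) (𝓝 l)) : MemLp u 2 (weightedMeasure β) :=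
  memLp_of_tendsto hβ hu.continuousOn hu.tendsto_zero h1

theorem eqOn_flux (hu : IsBesselPair s β q u U) : EqOn (fun x => x * deriv u x) U (Ioo 0 1) :=
  fun x hx => by
    have := hx.1.ne'
    simp only
    rw [(hu.hasDerivAt x hx).deriv]
    field_simp

/-- The Pohozaev identity. -/
theorem integral_sq (hu : IsBesselPair s β q u U) (hβ : -1 < β) {l L : ℝ}
    (h1 : Tendsto u (𝓝[<] 1) (𝓝 l)) (h1' : Tendsto U (𝓝[<] 1) (𝓝 L)) :
    (1 + β) * q * ∫ x in (0 : ℝ)..1, x ^ β * (u x * u x) = L ^ 2 + (q - s ^ 2) * l ^ 2 := by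
  have hm := hu.memLp hβ h1
  -- Multiplying the flux equation by `2 U` leads to this energy: only the derivative of the
  -- coefficient `q x ^ (1 + β)` survives.
  have hd : ∀ x ∈ Ioo (0 : ℝ) 1, HasDerivAt
      (fun x => U x ^ 2 + (q * x ^ (1 + β) - s ^ 2) * u x ^ 2)
      ((1 + β) * q * (x ^ β * (u x * u x))) x := fun x hx => by
    have hx0 : 0 < x := hx.1
    refine (((hu.hasDerivAt_flux x hx).pow 2).add (((((Real.hasDerivAt_rpow_const (p := 1 + β)
      (Or.inl hx0.ne')).const_mul q).sub_const (s ^ 2))).mul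
      ((hu.hasDerivAt x hx).pow 2))).congr_deriv ?_
    rw [Real.rpow_add hx0, Real.rpow_one, add_sub_cancel_left, Pi.pow_apply]
    field_simp
    push_cast
    ring
  have h0 : Tendsto (fun x => U x ^ 2 + (q * x ^ (1 + β) - s ^ 2) * u x ^ 2) (𝓝[>] 0) (𝓝 0) := by
    simpa using (hu.tendsto_flux_zero.pow 2).add
      ((((tendsto_rpow_nhdsGT_zero (by linarith : 0 < 1 + β)).const_mul q).sub_const (s ^ 2)).mul
        (hu.tendsto_zero.pow 2))
  have h2 : Tendsto (fun x => U x ^ 2 + (q * x ^ (1 + β) - s ^ 2) * u x ^ 2) (𝓝[<] 1)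
      (𝓝 (L ^ 2 + (q - s ^ 2) * l ^ 2)) := by
    simpa using (h1'.pow 2).add
      ((((tendsto_rpow_nhdsLT_one (1 + β)).const_mul q).sub_const (s ^ 2)).mul (h1.pow 2))
  have := intervalIntegral.integral_eq_sub_of_hasDerivAt_of_tendsto zero_lt_one hd
    ((integrable_mul_of_memLp hm hm).const_mul _) h0 h2
  rwa [intervalIntegral.integral_const_mul, sub_zero] at this

/-- A solution with vanishing Cauchy data at `1` vanishes. -/
theorem eq_zero (hu : IsBesselPair s β q u U) (hβ : -1 < β) (hq : 0 < q)
    (h1 : Tendsto u (𝓝[<] 1) (𝓝 0)) (h1' : Tendsto U (𝓝[<] 1) (𝓝 0)) :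
    EqOn u (fun _ => 0) (Ioo 0 1) := by
  have hm := hu.memLp hβ h1
  have h2 := hu.integral_sq hβ h1 h1'
  -- With zero Cauchy data the identity says that the weighted `L²` norm of `u` is zero.
  have h3 : inner ℝ (hm.toLp u) (hm.toLp u) = 0 := by
    rw [inner_eq_of_ae hm.coeFn_toLp hm.coeFn_toLp]
    have : (1 + β) * q ≠ 0 := (mul_pos (by linarith) hq).ne'
    refine (mul_eq_zero.1 (h2.trans ?_)).resolve_left this
    ring
  rw [inner_self_eq_zero] at h3
  have h4 : u =ᵐ[weightedMeasure β] fun _ => 0 := by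
    filter_upwards [hm.coeFn_toLp, Lp.coeFn_zero ℝ 2 (weightedMeasure β)] with x hx hx0
    rw [← hx, h3, hx0, Pi.zero_apply]
  rw [EventuallyEq, ae_weightedMeasure_iff] at h4
  exact Measure.eqOn_open_of_ae_eq h4 isOpen_Ioo hu.continuousOn continuousOn_const

/-- The Wronskian of two solutions vanishes at `1`. -/
theorem wronskian_eq (hu : IsBesselPair s β q u U) (hw : IsBesselPair s β q w W) {l L m M : ℝ}
    (h1 : Tendsto u (𝓝[<] 1) (𝓝 l)) (h1' : Tendsto U (𝓝[<] 1) (𝓝 L))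
    (h2 : Tendsto w (𝓝[<] 1) (𝓝 m)) (h2' : Tendsto W (𝓝[<] 1) (𝓝 M)) :
    l * M - L * m = 0 := by
  have hd : ∀ x ∈ Ioo (0 : ℝ) 1, HasDerivAt (fun x => u x * W x - U x * w x) 0 x :=
    fun x hx => (((hu.hasDerivAt x hx).mul (hw.hasDerivAt_flux x hx)).sub
      ((hu.hasDerivAt_flux x hx).mul (hw.hasDerivAt x hx))).congr_deriv (by
        have := hx.1.ne'
        field_simp
        ring)
  have h0 : Tendsto (fun x => u x * W x - U x * w x) (𝓝[>] 0) (𝓝 0) := by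
    simpa using (hu.tendsto_zero.mul hw.tendsto_flux_zero).sub
      (hu.tendsto_flux_zero.mul hw.tendsto_zero)
  have := intervalIntegral.integral_eq_sub_of_hasDerivAt_of_tendsto zero_lt_one hd
    (by simp) h0 ((h1.mul h2').sub (h1'.mul h2))
  rw [intervalIntegral.integral_zero, sub_zero] at this
  exact this.symm

theorem opA_eq (hu : IsBesselPair s β q u U) {α : ℝ} (hαβ : α + β = 1) :
    EqOn (opA α β (-s ^ 2) u) (fun x => q * u x) (Ioo 0 1) := fun x hx => by
  rw [opA_eq_of_hasDerivAt hαβ hx.1 ((hu.hasDerivAt_flux x hx).congr_of_eventuallyEq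
    (eventually_of_mem (isOpen_Ioo.mem_nhds hx) hu.eqOn_flux))]
  have e : x ^ (-β) * x ^ β = 1 := by rw [← Real.rpow_add hx.1]; simp
  linear_combination q * u x * e

theorem mem_Dmax (hu : IsBesselPair s β q u U) (hβ : -1 < β) {α l : ℝ} (hαβ : α + β = 1)
    (h1 : Tendsto u (𝓝[<] 1) (𝓝 l)) : u ∈ Dmax α β (-s ^ 2) := by
  have hm := hu.memLp hβ h1
  refine ⟨ACloc.of_hasDerivAt hu.hasDerivAt
      (hu.continuousOn_flux.div continuousOn_id fun x hx => hx.1.ne'),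
    (ACloc.of_hasDerivAt hu.hasDerivAt_flux ?_).congr hu.eqOn_flux.symm, hm,
    (memLp_congr_ae (ae_weightedMeasure_of_forall (hu.opA_eq hαβ))).2 (hm.const_mul q)⟩
  exact ((continuousOn_const.div continuousOn_id fun x hx => hx.1.ne').sub
    (continuousOn_const.mul (ACloc.rpow β).continuousOn)).mul hu.continuousOn

theorem eq_green (hu : IsBesselPair s β q u U) (hs : 0 < s) (hβ : -1 < β)
    (h1 : Tendsto u (𝓝[<] 1) (𝓝 0)) :
    EqOn u (green s β fun x => q * u x) (Ioo 0 1) := fun x hx => by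
  -- Neither the pair nor `green` involves `α`, so it may be taken to be `1 - β`.
  have hαβ : (1 - β) + β = 1 := by ring
  rw [eq_green_opA hαβ hs hβ (hu.mem_Dmax hβ hαβ h1) h1
    (fun _ => by simpa using (tendsto_rpow_nhdsGT_zero hs).mul hu.tendsto_zero) hx]
  exact green_congr (ae_weightedMeasure_of_forall (hu.opA_eq hαβ)) hx

theorem mem_domASq (hu : IsBesselPair s β q u U) (hs : 0 < s) (hβ : -1 < β) {α : ℝ}
    (hαβ : α + β = 1) (h1 : Tendsto u (𝓝[<] 1) (𝓝 0)) : u ∈ domASq α β (-s ^ 2) :=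
  mem_domASq_of_eqOn_green hαβ hs hβ
    ((hu.const_mul q).eq_green hs hβ (by simpa using h1.const_mul q)) (hu.eq_green hs hβ h1)
    (((hu.memLp hβ h1).const_mul q).const_mul q)

theorem opASq_eq (hu : IsBesselPair s β q u U) {α : ℝ} (hαβ : α + β = 1) {x : ℝ}
    (hx : x ∈ Ioo (0 : ℝ) 1) : opASq α β (-s ^ 2) u x = q ^ 2 * u x := by
  have hd : ∀ y ∈ Ioo (0 : ℝ) 1, HasDerivAt (fun y => U y / y)
      ((s ^ 2 / y - q * y ^ β) * u y / y - U y / y ^ 2) y := fun y hy => by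
    have hy0 := hy.1.ne'
    refine ((hu.hasDerivAt_flux y hy).div (hasDerivAt_id y) hy0).congr_deriv ?_
    simp only [id]
    field_simp
  rw [DegenerateFourthOrder.opASq_eq (v := fun y => q * u y) (v₁ := fun y => q * (U y / y)) hαβ hx
    hu.hasDerivAt (fun y hy => (hd y hy).congr_deriv ?_)
    (fun y hy => (hu.hasDerivAt y hy).const_mul q) ((hd x hx).const_mul q)]
  · have hx0 := hx.1.ne'
    have e : x ^ (-β) * x ^ β = 1 := by rw [← Real.rpow_add hx.1]; simp
    have e2 : (x * (U x / x ^ 2)) = U x / x := by field_simp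
    have e3 : x * ((s ^ 2 / x - q * x ^ β) * u x / x) = (s ^ 2 / x - q * x ^ β) * u x := by
      field_simp
    rw [mul_left_comm x q, mul_sub x, e2, e3]
    linear_combination q ^ 2 * u x * e
  · have hy0 := hy.1.ne'
    have e : y ^ β = y * y ^ (-α) := by
      rw [show β = 1 + -α by linarith, Real.rpow_add hy.1, Real.rpow_one]
    rw [e]
    field_simp
    ring

end IsBesselPair

/-! ### Eigenfunctions of Green's operator -/

/-- The solution `J_ν(c x ^ κ)` with its flux. -/
theorem isBesselPair_besselJ {s β κ ν c : ℝ} (hν : 0 < ν) (hκ : 0 < κ) (hκβ : 2 * κ = 1 + β)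
    (hs : s = κ * ν) (hc : 0 < c) :
    IsBesselPair s β (κ ^ 2 * c ^ 2) (fun x => besselJ ν (c * x ^ κ))
      (fun x => κ * besselE ν (c * x ^ κ)) := by
  have hpow : ∀ x ∈ Ioo (0 : ℝ) 1, HasDerivAt (fun x : ℝ => c * x ^ κ) (κ * (c * x ^ κ) / x) x :=
    fun x hx => ((Real.hasDerivAt_rpow_const (p := κ) (Or.inl hx.1.ne')).const_mul c).congr_deriv
      (by rw [Real.rpow_sub hx.1, Real.rpow_one]; ring)
  have hpos : ∀ x : ℝ, 0 < x → 0 < c * x ^ κ := fun x hx => by positivity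
  have hlim : Tendsto (fun x : ℝ => c * x ^ κ) (𝓝[>] 0) (𝓝[>] 0) := by
    refine tendsto_nhdsWithin_iff.2 ⟨by simpa using (tendsto_rpow_nhdsGT_zero hκ).const_mul c, ?_⟩
    filter_upwards [self_mem_nhdsWithin] with x hx using hpos x hx
  refine ⟨fun x hx => ?_, fun x hx => ?_, (tendsto_besselJ_zero hν).comp hlim, ?_⟩
  · have hy := hpos x hx.1
    have hκx : x ^ κ ≠ 0 := (Real.rpow_pos_of_pos hx.1 κ).ne'
    refine ((hasDerivAt_besselJ hν hy).comp x (hpow x hx)).congr_deriv ?_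
    field_simp
  · have hy := hpos x hx.1
    have hx0 : x ≠ 0 := hx.1.ne'
    have hκx : x ^ κ ≠ 0 := (Real.rpow_pos_of_pos hx.1 κ).ne'
    refine (((hasDerivAt_besselE hν hy).comp x (hpow x hx)).const_mul κ).congr_deriv ?_
    -- Here `2 κ = 1 + β` turns the term `y²` of Bessel's equation, at `y = c x ^ κ`, into the
    -- weight `x ^ β`.
    have e : x ^ β = x ^ κ * x ^ κ / x := by
      rw [← Real.rpow_add hx.1, show κ + κ = 1 + β by linarith, Real.rpow_add hx.1, Real.rpow_one]
      field_simp
    rw [e, hs]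
    field_simp
  · simpa using ((tendsto_besselE_zero hν).comp hlim).const_mul κ

theorem tendsto_comp_mul_rpow {f : ℝ → ℝ} {c : ℝ} (κ : ℝ) (hf : ContinuousAt f c) :
    Tendsto (fun x => f (c * x ^ κ)) (𝓝[<] 1) (𝓝 (f c)) := by
  refine hf.tendsto.comp ?_
  simpa using (tendsto_rpow_nhdsLT_one κ).const_mul c

theorem not_eqOn_besselJ_zero {κ ν c : ℝ} (hν : 0 < ν) (hκ : 0 < κ) (hc : 0 < c) :
    ¬ EqOn (fun x => besselJ ν (c * x ^ κ)) (fun _ => 0) (Ioo 0 1) := by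
  intro h
  have hlim : Tendsto (fun x : ℝ => c * x ^ κ) (𝓝[>] 0) (𝓝[>] 0) := by
    refine tendsto_nhdsWithin_iff.2 ⟨by simpa using (tendsto_rpow_nhdsGT_zero hκ).const_mul c, ?_⟩
    filter_upwards [self_mem_nhdsWithin] with x hx
    have : (0 : ℝ) < x := hx
    exact mem_Ioi.2 (by positivity)
  obtain ⟨x, hx, hx1⟩ := ((hlim.eventually (eventually_besselJ_pos hν)).and
    (Ioo_mem_nhdsGT (zero_lt_one' ℝ))).exists
  exact hx.ne' (h hx1)

/-- The positive zeros of `J_ν` are simple. -/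
theorem besselE_ne_zero {ν c : ℝ} (hν : 0 < ν) (hc : 0 < c) (h0 : besselJ ν c = 0) :
    besselE ν c ≠ 0 := by
  intro hE
  -- For `κ = β = 1`, a double zero at `c` would give `J_ν(c x)` zero Cauchy data at `x = 1`, so it
  -- would vanish on `(0, 1)`.
  have hp := isBesselPair_besselJ (s := ν) (β := 1) (κ := 1) hν one_pos (by norm_num) (by ring) hc
  refine not_eqOn_besselJ_zero (κ := 1) hν one_pos hc (hp.eq_zero (by norm_num) (by positivity)
    ?_ ?_)
  · simpa only [h0] using tendsto_comp_mul_rpow 1 (continuousAt_besselJ hν hc)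
  · simpa [hE] using
      (tendsto_comp_mul_rpow 1 (hasDerivAt_besselE hν hc).continuousAt).const_mul 1

/-- This is the Pohozaev identity with `l = 0` and `L = κ c J_ν'(c)`, divided by `q = κ² c²`. -/
theorem integral_besselJ_sq {β κ ν c : ℝ} (hν : 0 < ν) (hκ : 0 < κ) (hκβ : 2 * κ = 1 + β)
    (hc : 0 < c) (h0 : besselJ ν c = 0) :
    2 * κ * ∫ x in (0 : ℝ)..1, x ^ β * (besselJ ν (c * x ^ κ) * besselJ ν (c * x ^ κ))
      = deriv (besselJ ν) c ^ 2 := by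
  have h1 := (isBesselPair_besselJ hν hκ hκβ rfl hc).integral_sq (by linarith)
    (tendsto_comp_mul_rpow κ (continuousAt_besselJ hν hc))
    ((tendsto_comp_mul_rpow κ (hasDerivAt_besselE hν hc).continuousAt).const_mul κ)
  have h2 : κ ^ 2 * c ^ 2 ≠ 0 := by positivity
  refine mul_left_cancel₀ h2 ?_
  rw [h0, besselE] at h1
  rw [hκβ]
  linear_combination h1

theorem greenOp_eq_of_isBesselPair {s β q : ℝ} {u U : ℝ → ℝ} (hu : IsBesselPair s β q u U)
    (hs : 0 < s) (hβ : -1 < β) (h : -1 < β + 2 * s) (h1 : Tendsto u (𝓝[<] 1) (𝓝 0))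
    (hq : q ≠ 0) {f : L2w β} (hf : f =ᵐ[weightedMeasure β] u) :
    greenOp hβ h f = q⁻¹ • f := by
  have e1 : q • f =ᵐ[weightedMeasure β] fun x => q * u x := by
    filter_upwards [Lp.coeFn_smul q f, hf] with x hx hx'
    rw [hx, Pi.smul_apply, hx', smul_eq_mul]
  have e2 : greenOp hβ h (q • f) = f := Lp.ext
    (((greenOp_coeFn hs hβ h e1).trans
      (ae_weightedMeasure_of_forall (hu.eq_green hs hβ h1).symm)).trans hf.symm)
  rw [eq_inv_smul_iff₀ hq, ← map_smul, e2]

theorem eigenvalue_pos {s β lam : ℝ} (hβ : -1 < β) (h : -1 < β + 2 * s) {f : L2w β} (hf : f ≠ 0)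
    (hlam : greenOp hβ h f = lam • f) : 0 < lam := by
  have h1 := inner_greenOp_self hβ h f
  rw [hlam, real_inner_smul_left, real_inner_self_eq_norm_sq] at h1
  have h2 : hardyOp hβ h f ≠ 0 := fun h0 =>
    hf ((injective_iff_map_eq_zero _).1 (injective_hardyOp hβ h) f h0)
  have h3 : 0 < ‖f‖ ^ 2 := by positivity
  have h4 : 0 < ‖hardyOp hβ h f‖ ^ 2 := by positivity
  rw [← h1] at h4
  exact (pos_iff_pos_of_mul_pos h4).2 h3

/-- Bootstrap from `f = lam⁻¹ G f`: one application of `green` gives a continuous representative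
`v`, and a second one gives a function whose flux is differentiable everywhere. -/
theorem exists_isBesselPair_of_eigenvector {s β lam : ℝ} (hs : 0 < s) (hβ : -1 < β)
    (h : -1 < β + 2 * s) {f : L2w β} (hlam0 : lam ≠ 0) (hlam : greenOp hβ h f = lam • f) :
    ∃ (u U : ℝ → ℝ) (L : ℝ), f =ᵐ[weightedMeasure β] u ∧ IsBesselPair s β lam⁻¹ u U ∧
      Tendsto u (𝓝[<] 1) (𝓝 0) ∧ Tendsto U (𝓝[<] 1) (𝓝 L) := by
  have hstep : ∀ {v : ℝ → ℝ}, f =ᵐ[weightedMeasure β] v →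
      f =ᵐ[weightedMeasure β] fun x => lam⁻¹ * green s β v x := fun {v} hv => by
    have h1 := greenOp_coeFn hs hβ h hv
    rw [hlam] at h1
    filter_upwards [h1, Lp.coeFn_smul lam f] with x hx hx'
    rw [← hx, hx', Pi.smul_apply, smul_eq_mul, inv_mul_cancel_left₀ hlam0]
  set v : ℝ → ℝ := fun x => lam⁻¹ * green s β f x with hv
  have hfv : f =ᵐ[weightedMeasure β] v := hstep (ae_eq_refl _)
  have hvm : MemLp v 2 (weightedMeasure β) := (memLp_green hs hβ (Lp.memLp f)).const_mul _
  have hvc : ContinuousOn v (Ioo 0 1) :=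
    continuousOn_const.mul (continuousOn_green h (Lp.memLp f))
  have huv : EqOn (fun x => lam⁻¹ * green s β v x) v (Ioo 0 1) := fun x hx => by
    simp only [hv]
    rw [green_congr hfv hx]
  refine ⟨fun x => lam⁻¹ * green s β v x, fun x => lam⁻¹ * greenFlux s β v x,
    lam⁻¹ * -prim s β v 1, hstep hfv, ⟨fun x hx => ?_, fun x hx => ?_, ?_, ?_⟩, ?_, ?_⟩
  · exact ((hasDerivAt_green h hvm hx).const_mul lam⁻¹).congr_deriv (by ring)
  · refine ((hasDerivAt_greenFlux h hvm hx (hasDerivAt_prim h hvm hvc hx)).const_mul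
      lam⁻¹).congr_deriv ?_
    rw [← huv hx]
    ring
  · simpa using (tendsto_green_zero hs hβ hvm).const_mul lam⁻¹
  · simpa using (tendsto_greenFlux_zero hs hβ hvm).const_mul lam⁻¹
  · simpa using (tendsto_green_one h hvm).const_mul lam⁻¹
  · exact (tendsto_greenFlux_one h hvm).const_mul lam⁻¹

/-- The eigenfunctions of Green's operator are the functions `J_ν(c x ^ κ)` with `J_ν(c) = 0`. -/
theorem exists_zero_of_eigenvector {s β κ ν lam : ℝ} (hν : 0 < ν) (hκ : 0 < κ)
    (hκβ : 2 * κ = 1 + β) (hsν : s = κ * ν) (hβ : -1 < β) (h : -1 < β + 2 * s) {f : L2w β}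
    (hf : f ≠ 0) (hlam : greenOp hβ h f = lam • f) :
    ∃ c a : ℝ, 0 < c ∧ besselJ ν c = 0 ∧
      f =ᵐ[weightedMeasure β] fun x => a * besselJ ν (c * x ^ κ) := by
  have hs : 0 < s := by rw [hsν]; positivity
  have hpos := eigenvalue_pos hβ h hf hlam
  obtain ⟨u, U, L, hfu, hu, h1, h1'⟩ := exists_isBesselPair_of_eigenvector hs hβ h hpos.ne' hlam
  set c := (κ * √lam)⁻¹ with hc
  have hc0 : 0 < c := by positivity
  have hq : lam⁻¹ = κ ^ 2 * c ^ 2 := by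
    rw [hc, inv_pow, mul_pow, Real.sq_sqrt hpos.le]
    field_simp
  rw [hq] at hu
  have hw := isBesselPair_besselJ hν hκ hκβ hsν hc0
  have h2 := tendsto_comp_mul_rpow κ (continuousAt_besselJ hν hc0)
  have h2' := (tendsto_comp_mul_rpow κ (hasDerivAt_besselE hν hc0).continuousAt).const_mul κ
  -- The flux at `1` cannot vanish, or `u` would have zero Cauchy data there. The Wronskian identity
  -- `-L J_ν(c) = 0` then gives `J_ν(c) = 0`.
  have hL : L ≠ 0 := fun hL => by
    rw [hL] at h1'
    refine hf (Lp.eq_zero_iff_ae_eq_zero.2 (hfu.trans (ae_weightedMeasure_of_forall ?_)))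
    exact hu.eq_zero hβ (by positivity) h1 h1'
  have hJ : besselJ ν c = 0 := by
    have := hu.wronskian_eq hw h1 h1' h2 h2'
    rw [zero_mul, zero_sub, neg_eq_zero] at this
    exact (mul_eq_zero.1 this).resolve_left hL
  have hE := besselE_ne_zero hν hc0 hJ
  refine ⟨c, L / (κ * besselE ν c), hc0, hJ, hfu.trans (ae_weightedMeasure_of_forall fun x hx => ?_)⟩
  -- The multiple is chosen to cancel the flux at `1`; both functions already vanish there, so the
  -- difference is zero.
  have hd := (hu.sub_const_mul hw (L / (κ * besselE ν c))).eq_zero hβ (by positivity) ?_ ?_ hx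
  · exact sub_eq_zero.1 hd
  · rw [hJ] at h2
    simpa using h1.sub (h2.const_mul (L / (κ * besselE ν c)))
  · have := h1'.sub (h2'.const_mul (L / (κ * besselE ν c)))
    rwa [div_mul_cancel₀ L (mul_ne_zero hκ.ne' hE), sub_self] at this

/-! ### The positive zeros of the Bessel function -/

/-- The set of positive zeros of `J_ν`. -/
def posZeros (ν : ℝ) : Set ℝ := {x | 0 < x ∧ besselJ ν x = 0}

/-- Positive zeros are isolated because they are simple, and they cannot accumulate at `0` because
`J_ν > 0` just to the right of `0`. -/
theorem eventually_notMem_posZeros {ν x : ℝ} (hν : 0 < ν) (hx : 0 ≤ x) :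
    ∀ᶠ y in 𝓝[≠] x, y ∉ posZeros ν := by
  rcases hx.eq_or_lt with rfl | hx
  · rw [← Iio_union_Ioi, nhdsWithin_union]
    refine eventually_sup.2 ⟨?_, ?_⟩
    · filter_upwards [self_mem_nhdsWithin] with y hy hy' using lt_asymm hy hy'.1
    · filter_upwards [eventually_besselJ_pos hν] with y hy hy' using hy.ne' hy'.2
  · by_cases h0 : besselJ ν x = 0
    · have hd := (hasDerivAt_besselJ hν hx).eventually_ne (c := 0)
        (div_ne_zero (besselE_ne_zero hν hx h0) hx.ne')
      exact hd.mono fun y hy hy' => hy hy'.2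
    · have := (continuousAt_besselJ hν hx).eventually_ne h0
      exact nhdsWithin_le_nhds (this.mono fun y hy hy' => hy hy'.2)

theorem finite_posZeros_inter_Icc {ν : ℝ} (hν : 0 < ν) (R : ℝ) :
    (posZeros ν ∩ Icc 0 R).Finite := by
  by_contra hinf
  obtain ⟨x, hx, hacc⟩ := Set.Infinite.exists_accPt_of_subset_isCompact hinf
    (isCompact_Icc (a := 0) (b := R)) inter_subset_right
  rw [accPt_iff_frequently_nhdsNE] at hacc
  exact hacc ((eventually_notMem_posZeros hν hx.1).mono fun y hy hy' => hy hy'.1)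

/-- The functions `J_ν(c x ^ κ)`, for positive zeros `c` of `J_ν`, as elements of `L²_β`. -/
theorem memLp_besselJ {β κ ν c : ℝ} (hν : 0 < ν) (hκ : 0 < κ) (hκβ : 2 * κ = 1 + β) (hc : 0 < c) :
    MemLp (fun x => besselJ ν (c * x ^ κ)) 2 (weightedMeasure β) :=
  (isBesselPair_besselJ hν hκ hκβ rfl hc).memLp (by linarith)
    (tendsto_comp_mul_rpow κ (continuousAt_besselJ hν hc))

/-- The eigenspaces of the compact symmetric `G` have trivial common orthogonal complement, and
every eigenvector is a multiple of a vector in `V`. A general `V` serves both the infinitude of the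
zeros and the basis. -/
theorem orthogonal_span_eq_bot {s β κ ν : ℝ} (hν : 0 < ν) (hκ : 0 < κ) (hκβ : 2 * κ = 1 + β)
    (hsν : s = κ * ν) (hβ : -1 < β) (h : -1 < β + 2 * s) {V : Submodule ℝ (L2w β)}
    (hV : ∀ c, (hc : 0 < c) → besselJ ν c = 0 → (memLp_besselJ hν hκ hκβ hc).toLp _ ∈ V) :
    Vᗮ = ⊥ := by
  rw [← le_bot_iff, ← ContinuousLinearMap.orthogonalComplement_iSup_eigenspaces_eq_bot
    (isCompactOperator_greenOp hβ h) (isSymmetric_greenOp hβ h)]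
  refine Submodule.orthogonal_le (iSup_le fun lam f hf => ?_)
  have hlam : greenOp hβ h f = lam • f := Module.End.mem_eigenspace_iff.1 hf
  by_cases hf0 : f = 0
  · rw [hf0]
    exact V.zero_mem
  obtain ⟨c, a, hc, h0, hfa⟩ := exists_zero_of_eigenvector hν hκ hκβ hsν hβ h hf0 hlam
  have e : f = a • (memLp_besselJ hν hκ hκβ hc).toLp _ := by
    rw [← MemLp.toLp_const_smul]
    exact Lp.ext (hfa.trans (MemLp.coeFn_toLp _).symm)
  rw [e]
  exact V.smul_mem a (hV c hc h0)

/-- With finitely many zeros, the case `κ = β = 1` of completeness would make `L2w 1` finite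
dimensional and the injective `G` onto. But every value of `G` tends to `0` at the origin, so the
constant `1` is not attained. -/
theorem infinite_posZeros {ν : ℝ} (hν : 0 < ν) : (posZeros ν).Infinite := by
  intro hfin
  have hκβ : 2 * (1 : ℝ) = 1 + 1 := by norm_num
  have hβ : (-1 : ℝ) < 1 := by norm_num
  have h : -1 < (1 : ℝ) + 2 * ν := by linarith
  have : Finite (posZeros ν) := hfin
  let v : posZeros ν → L2w 1 := fun c => (memLp_besselJ hν one_pos hκβ c.2.1).toLp _
  let V : Submodule ℝ (L2w 1) := Submodule.span ℝ (range v)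
  have hfd : FiniteDimensional ℝ V := FiniteDimensional.span_of_finite ℝ (finite_range v)
  have hVbot : Vᗮ = ⊥ := orthogonal_span_eq_bot hν one_pos hκβ (one_mul ν).symm hβ h
    fun c hc h0 => Submodule.subset_span ⟨⟨c, hc, h0⟩, rfl⟩
  have hVtop : V = ⊤ := (Submodule.orthogonal_eq_bot_iff).1 hVbot
  have hfd' : FiniteDimensional ℝ (L2w 1) := by
    rw [hVtop] at hfd
    exact Submodule.topEquiv.finiteDimensional
  have hsurj : Function.Surjective (greenOp hβ h : L2w 1 →ₗ[ℝ] L2w 1) :=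
    LinearMap.injective_iff_surjective.1 (injective_greenOp hβ h)
  have hone : MemLp (fun _ : ℝ => (1 : ℝ)) 2 (weightedMeasure 1) :=
    memLp_of_continuousOn_of_bound (C := 1) hβ continuousOn_const fun _ _ => by simp
  obtain ⟨f, hf⟩ := hsurj (hone.toLp _)
  have hf' : greenOp hβ h f = hone.toLp _ := hf
  have h1 := greenOp_coeFn hν hβ h (ae_eq_refl f)
  rw [hf'] at h1
  have h2 := hone.coeFn_toLp.symm.trans h1
  rw [EventuallyEq, ae_weightedMeasure_iff] at h2
  have h3 := Measure.eqOn_open_of_ae_eq h2 isOpen_Ioo continuousOn_const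
    (continuousOn_green h (Lp.memLp f))
  have h4 := tendsto_nhds_unique ((tendsto_green_zero hν hβ (Lp.memLp f)).congr'
    (eventually_of_mem (Ioo_mem_nhdsGT (zero_lt_one' ℝ)) h3.symm)) tendsto_const_nhds
  exact zero_ne_one h4

theorem exists_posZeros_gt {ν : ℝ} (hν : 0 < ν) (r : ℝ) : ∃ x ∈ posZeros ν, r < x := by
  by_contra! hle
  exact infinite_posZeros hν ((finite_posZeros_inter_Icc hν r).subset fun x hx =>
    ⟨hx, hx.1.le, hle x hx⟩)

/-- The set is nonempty, so the default value of `sInf` plays no role, and the infimum is attained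
because zeros do not accumulate at it. -/
theorem sInf_zeros_mem {ν r : ℝ} (hν : 0 < ν) (hr : 0 ≤ r) :
    sInf {x | r < x ∧ besselJ ν x = 0} ∈ {x | r < x ∧ besselJ ν x = 0} := by
  set S := {x | r < x ∧ besselJ ν x = 0} with hS
  have hne : S.Nonempty := by
    obtain ⟨x, hx, hrx⟩ := exists_posZeros_gt hν r
    exact ⟨x, hrx, hx.2⟩
  have hbdd : BddBelow S := ⟨r, fun x hx => hx.1.le⟩
  have hi : 0 ≤ sInf S := hr.trans (le_csInf hne fun x hx => hx.1.le)
  by_contra hmem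
  have hfreq := mem_closure_iff_frequently.1 (csInf_mem_closure hne hbdd)
  refine hfreq ?_
  have := eventually_nhdsWithin_iff.1 (eventually_notMem_posZeros hν hi)
  filter_upwards [this] with y hy hyS
  by_cases hyi : y = sInf S
  · exact hmem (hyi ▸ hyS)
  · exact hy hyi ⟨hr.trans_lt hyS.1, hyS.2⟩

theorem besselZero_nonneg {ν : ℝ} (hν : 0 < ν) : ∀ k, 0 ≤ besselZero ν k
  | 0 => le_rfl
  | k + 1 => (besselZero_nonneg hν k).trans (sInf_zeros_mem hν (besselZero_nonneg hν k)).1.le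

theorem besselZero_lt_succ {ν : ℝ} (hν : 0 < ν) (k : ℕ) :
    besselZero ν k < besselZero ν (k + 1) :=
  (sInf_zeros_mem hν (besselZero_nonneg hν k)).1

theorem besselZero_succ_mem {ν : ℝ} (hν : 0 < ν) (k : ℕ) :
    besselZero ν (k + 1) ∈ posZeros ν :=
  ⟨(besselZero_nonneg hν k).trans_lt (besselZero_lt_succ hν k),
    (sInf_zeros_mem hν (besselZero_nonneg hν k)).2⟩

theorem strictMono_besselZero {ν : ℝ} (hν : 0 < ν) : StrictMono (besselZero ν) :=
  strictMono_nat_of_lt_succ (besselZero_lt_succ hν)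

/-- The terms cannot all lie below `c`, since `[0, c]` contains finitely many zeros. At the first
index with `c ≤ besselZero ν (k + 1)`, the point `c` competes in the infimum defining that term, so
equality holds. -/
theorem exists_besselZero_eq {ν c : ℝ} (hν : 0 < ν) (hc : c ∈ posZeros ν) :
    ∃ k, besselZero ν (k + 1) = c := by
  have hex : ∃ k, c ≤ besselZero ν k := by
    by_contra! hlt
    have hinj : Function.Injective fun k : ℕ => besselZero ν (k + 1) := fun k l hkl =>
      Nat.succ_injective ((strictMono_besselZero hν).injective hkl)
    refine (infinite_range_of_injective hinj) ((finite_posZeros_inter_Icc hν c).subset ?_)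
    rintro _ ⟨k, rfl⟩
    exact ⟨besselZero_succ_mem hν k, besselZero_nonneg hν _, (hlt _).le⟩
  classical
  obtain ⟨k, hk⟩ : ∃ k, Nat.find hex = k + 1 := Nat.exists_eq_succ_of_ne_zero fun h0 => by
    have h1 := Nat.find_spec hex
    rw [h0] at h1
    exact absurd hc.1 (not_lt.2 h1)
  refine ⟨k, le_antisymm ?_ (hk ▸ Nat.find_spec hex)⟩
  have hlt : besselZero ν k < c := not_le.1 (Nat.find_min hex (by omega))
  exact csInf_le ⟨besselZero ν k, fun x hx => hx.1.le⟩ ⟨hlt, hc.2⟩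

theorem range_besselZero {ν : ℝ} (hν : 0 < ν) :
    range (fun k : ℕ => besselZero ν (k + 1)) = {x : ℝ | 0 < x ∧ besselJ ν x = 0} := by
  ext c
  exact ⟨fun ⟨k, hk⟩ => hk ▸ besselZero_succ_mem hν k, fun hc => exists_besselZero_eq hν hc⟩

/-! ### The orthonormal basis -/

theorem nu_eq {α s β : ℝ} (hαβ : α + β = 1) (hs : 0 < s) : nu α β (-s ^ 2) = s / kappa α := by
  rw [nu, muCrit, hαβ, sub_self, zero_pow two_ne_zero, zero_div, zero_sub, sqrt_neg_neg_sq hs]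

section Basis

variable {α s β : ℝ}

theorem kappa_pos (hα : α < 2) : 0 < kappa α := by
  rw [kappa]
  linarith

theorem two_mul_kappa (hαβ : α + β = 1) : 2 * kappa α = 1 + β := by
  rw [kappa]
  linarith

theorem nu_pos (hα : α < 2) (hαβ : α + β = 1) (hs : 0 < s) : 0 < nu α β (-s ^ 2) := by
  rw [nu_eq hαβ hs]
  exact div_pos hs (kappa_pos hα)

theorem eq_kappa_mul_nu (hα : α < 2) (hαβ : α + β = 1) (hs : 0 < s) :
    s = kappa α * nu α β (-s ^ 2) := by
  rw [nu_eq hαβ hs, mul_div_cancel₀ _ (kappa_pos hα).ne']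

/-- The normalizing factor of `Phi`. -/
def phiCoeff (α β μ : ℝ) (k : ℕ) : ℝ :=
  √(2 * kappa α) / |deriv (besselJ (nu α β μ)) (besselZero (nu α β μ) k)|

theorem Phi_eq (hαβ : α + β = 1) (μ : ℝ) (k : ℕ) :
    Phi α β μ k = fun x => phiCoeff α β μ k *
      besselJ (nu α β μ) (besselZero (nu α β μ) k * x ^ kappa α) := by
  ext x
  rw [Phi, phiCoeff, show (1 - α - β) / 2 = 0 by linarith, Real.rpow_zero, mul_one]

theorem deriv_besselJ_ne_zero {ν c : ℝ} (hν : 0 < ν) (hc : c ∈ posZeros ν) :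
    deriv (besselJ ν) c ≠ 0 := fun h0 =>
  besselE_ne_zero hν hc.1 hc.2 (by rw [besselE, h0, mul_zero])

theorem phiCoeff_ne_zero (hα : α < 2) (hαβ : α + β = 1) (hs : 0 < s) (k : ℕ) :
    phiCoeff α β (-s ^ 2) (k + 1) ≠ 0 := by
  have hκ := kappa_pos hα
  have hν := nu_pos hα hαβ hs
  have h1 := deriv_besselJ_ne_zero hν (besselZero_succ_mem hν k)
  exact div_ne_zero (Real.sqrt_pos.2 (by positivity)).ne' (abs_ne_zero.2 h1)

theorem isBesselPair_Phi (hα : α < 2) (hαβ : α + β = 1) (hs : 0 < s) (k : ℕ) :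
    IsBesselPair s β (kappa α ^ 2 * besselZero (nu α β (-s ^ 2)) (k + 1) ^ 2)
      (Phi α β (-s ^ 2) (k + 1)) (fun x => phiCoeff α β (-s ^ 2) (k + 1) * (kappa α *
        besselE (nu α β (-s ^ 2)) (besselZero (nu α β (-s ^ 2)) (k + 1) * x ^ kappa α))) := by
  have hν := nu_pos hα hαβ hs
  rw [Phi_eq hαβ]
  exact (isBesselPair_besselJ hν (kappa_pos hα) (two_mul_kappa hαβ) (eq_kappa_mul_nu hα hαβ hs)
    (besselZero_succ_mem hν k).1).const_mul _

theorem tendsto_Phi_one (hα : α < 2) (hαβ : α + β = 1) (hs : 0 < s) (k : ℕ) :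
    Tendsto (Phi α β (-s ^ 2) (k + 1)) (𝓝[<] 1) (𝓝 0) := by
  have hν := nu_pos hα hαβ hs
  have hz := besselZero_succ_mem hν k
  rw [Phi_eq hαβ]
  have := (tendsto_comp_mul_rpow (kappa α) (continuousAt_besselJ hν hz.1)).const_mul
    (phiCoeff α β (-s ^ 2) (k + 1))
  rwa [hz.2, mul_zero] at this

theorem memLp_Phi (hα : α < 2) (hαβ : α + β = 1) (hs : 0 < s) (k : ℕ) :
    MemLp (Phi α β (-s ^ 2) (k + 1)) 2 (weightedMeasure β) :=
  (isBesselPair_Phi hα hαβ hs k).memLp (by linarith) (tendsto_Phi_one hα hαβ hs k)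

theorem Phi_mem_domASq (hα : α < 2) (hαβ : α + β = 1) (hs : 0 < s) (k : ℕ) :
    Phi α β (-s ^ 2) (k + 1) ∈ domASq α β (-s ^ 2) :=
  (isBesselPair_Phi hα hαβ hs k).mem_domASq hs (by linarith) hαβ (tendsto_Phi_one hα hαβ hs k)

theorem integral_Phi_sq (hα : α < 2) (hαβ : α + β = 1) (hs : 0 < s) (k : ℕ) :
    ∫ x in (0 : ℝ)..1, x ^ β * (Phi α β (-s ^ 2) (k + 1) x * Phi α β (-s ^ 2) (k + 1) x) = 1 := by
  have hν := nu_pos hα hαβ hs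
  have hκ := kappa_pos hα
  have hz := besselZero_succ_mem hν k
  have h1 := integral_besselJ_sq hν hκ (two_mul_kappa hαβ) hz.1 hz.2
  have h2 := deriv_besselJ_ne_zero hν hz
  have h3 : phiCoeff α β (-s ^ 2) (k + 1) ^ 2 = 2 * kappa α /
      deriv (besselJ (nu α β (-s ^ 2))) (besselZero (nu α β (-s ^ 2)) (k + 1)) ^ 2 := by
    rw [phiCoeff, div_pow, sq_abs, Real.sq_sqrt (by positivity)]
  rw [Phi_eq hαβ]
  set ν := nu α β (-s ^ 2)
  set j := besselZero ν (k + 1)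
  have h4 : ∀ x : ℝ, x ^ β * (phiCoeff α β (-s ^ 2) (k + 1) * besselJ ν (j * x ^ kappa α) *
      (phiCoeff α β (-s ^ 2) (k + 1) * besselJ ν (j * x ^ kappa α)))
      = phiCoeff α β (-s ^ 2) (k + 1) ^ 2 *
        (x ^ β * (besselJ ν (j * x ^ kappa α) * besselJ ν (j * x ^ kappa α))) := fun x => by ring
  simp only [h4]
  rw [intervalIntegral.integral_const_mul, h3, div_mul_eq_mul_div, h1,
    div_self (pow_ne_zero 2 h2)]

theorem greenOp_Phi (hα : α < 2) (hαβ : α + β = 1) (hs : 0 < s) (hβ : -1 < β)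
    (h : -1 < β + 2 * s) (k : ℕ) :
    greenOp hβ h ((memLp_Phi hα hαβ hs k).toLp _)
      = (kappa α ^ 2 * besselZero (nu α β (-s ^ 2)) (k + 1) ^ 2)⁻¹ •
        (memLp_Phi hα hαβ hs k).toLp _ := by
  have hν := nu_pos hα hαβ hs
  have hκ := kappa_pos hα
  have hz := (besselZero_succ_mem hν k).1
  exact greenOp_eq_of_isBesselPair (isBesselPair_Phi hα hαβ hs k) hs hβ h
    (tendsto_Phi_one hα hαβ hs k) (by positivity) (MemLp.coeFn_toLp _)

/-- Orthogonality holds because these are eigenvectors of the symmetric `G` with different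
eigenvalues `(κ j_{ν,k})⁻²`. -/
theorem orthonormal_Phi (hα : α < 2) (hαβ : α + β = 1) (hs : 0 < s) :
    Orthonormal ℝ fun k : ℕ => (memLp_Phi hα hαβ hs k).toLp (Phi α β (-s ^ 2) (k + 1)) := by
  have hβ : -1 < β := by linarith
  have h := neg_one_lt_add_two_mul hs hβ
  have hν := nu_pos hα hαβ hs
  have hκ := kappa_pos hα
  refine ⟨fun k => ?_, fun k l hkl => ?_⟩
  · have h1 := inner_eq_of_ae (memLp_Phi hα hαβ hs k).coeFn_toLp
      (memLp_Phi hα hαβ hs k).coeFn_toLp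
    rw [integral_Phi_sq hα hαβ hs k, real_inner_self_eq_norm_sq] at h1
    exact (pow_eq_one_iff_of_nonneg (norm_nonneg _) two_ne_zero).1 h1
  · have h1 := inner_greenOp_comm hβ h ((memLp_Phi hα hαβ hs k).toLp _)
      ((memLp_Phi hα hαβ hs l).toLp _)
    rw [greenOp_Phi hα hαβ hs hβ h k, greenOp_Phi hα hαβ hs hβ h l, real_inner_smul_left,
      real_inner_smul_right,
      mul_eq_mul_right_iff] at h1
    refine h1.resolve_left fun h2 => hkl ?_
    have hk := (besselZero_succ_mem hν k).1
    have hl := (besselZero_succ_mem hν l).1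
    have h3 := mul_left_cancel₀ (by positivity) (inv_injective h2)
    exact Nat.succ_injective ((strictMono_besselZero hν).injective
      ((sq_eq_sq₀ hk.le hl.le).1 h3))

theorem exists_hilbertBasis_Phi (hα : α < 2) (hαβ : α + β = 1) (hs : 0 < s) :
    ∃ b : HilbertBasis ℕ ℝ (L2w β),
      ∀ k : ℕ, b k =ᵐ[weightedMeasure β] Phi α β (-s ^ 2) (k + 1) := by
  have hβ : -1 < β := by linarith
  have h := neg_one_lt_add_two_mul hs hβ
  have hν := nu_pos hα hαβ hs
  have hsp : (Submodule.span ℝ (range fun k : ℕ =>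
      (memLp_Phi hα hαβ hs k).toLp (Phi α β (-s ^ 2) (k + 1))))ᗮ = ⊥ := by
    refine orthogonal_span_eq_bot hν (kappa_pos hα) (two_mul_kappa hαβ)
      (eq_kappa_mul_nu hα hαβ hs) hβ h fun c hc h0 => ?_
    obtain ⟨k, rfl⟩ := exists_besselZero_eq hν ⟨hc, h0⟩
    have e : (memLp_besselJ hν (kappa_pos hα) (two_mul_kappa hαβ) hc).toLp _
        = (phiCoeff α β (-s ^ 2) (k + 1))⁻¹ • (memLp_Phi hα hαβ hs k).toLp _ := by
      rw [← MemLp.toLp_const_smul]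
      refine MemLp.toLp_congr _ _ (Eventually.of_forall fun x => ?_)
      rw [Pi.smul_apply, Phi_eq hαβ, smul_eq_mul,
        inv_mul_cancel_left₀ (phiCoeff_ne_zero hα hαβ hs k)]
    rw [e]
    exact Submodule.smul_mem _ _ (Submodule.subset_span ⟨k, rfl⟩)
  refine ⟨HilbertBasis.mkOfOrthogonalEqBot (orthonormal_Phi hα hαβ hs) hsp, fun k => ?_⟩
  rw [HilbertBasis.coe_mkOfOrthogonalEqBot]
  exact MemLp.coeFn_toLp _

end Basis

end DegenerateFourthOrder

end

/-! ### The main theorem. -/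

open DegenerateFourthOrder in
theorem proposition5p2 (α β μ : ℝ) (hα0 : 0 ≤ α) (hα2 : α < 2) (hαβ : α + β = 1) (hμ : μ < 0) :
    -- the expanded expression is the square of `𝒜` on the domain
    (∀ u ∈ domASq α β μ, ∀ᵐ x ∂(volume.restrict (Ioo (0 : ℝ) 1)),
      opASq α β μ u x = opA α β μ (opA α β μ u) x) ∧
    -- `-𝒜²` is a densely defined, negative, self-adjoint operator
    (∃ T : L2w β →ₗ.[ℝ] L2w β, IsNegASq α β μ T ∧
      Dense (T.domain : Set (L2w β)) ∧
      IsSelfAdjoint T ∧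
      ∀ f : T.domain, f ≠ 0 → inner ℝ (T f) (f : L2w β) < 0) ∧
    -- `j_{ν,1} < j_{ν,2} < ⋯` are the positive zeros of `J_ν`
    StrictMono (besselZero (nu α β μ)) ∧
    (Set.range fun k : ℕ => besselZero (nu α β μ) (k + 1))
      = {x : ℝ | 0 < x ∧ besselJ (nu α β μ) x = 0} ∧
    -- the `Φ_k`, `k ≥ 1`, form an orthonormal basis
    (∃ b : HilbertBasis ℕ ℝ (L2w β),
      ∀ k : ℕ, b k =ᵐ[weightedMeasure β] Phi α β μ (k + 1)) ∧
    -- and are eigenfunctions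
    (∀ k : ℕ, 1 ≤ k → Phi α β μ k ∈ domASq α β μ ∧
      ∀ x ∈ Ioo (0 : ℝ) 1,
        opASq α β μ (Phi α β μ k) x
          = kappa α ^ 4 * besselZero (nu α β μ) k ^ 4 * Phi α β μ k x) := by
  obtain ⟨s, hs, rfl⟩ : ∃ s : ℝ, 0 < s ∧ μ = -s ^ 2 :=
    ⟨√(-μ), Real.sqrt_pos.2 (by linarith), by rw [Real.sq_sqrt (by linarith), neg_neg]⟩
  have hβ : -1 < β := by linarith
  have h := neg_one_lt_add_two_mul hs hβ
  have hν := nu_pos hα2 hαβ hs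
  refine ⟨fun u hu => ae_opASq_eq hαβ hu.1 hu.2.1,
    ⟨negASq hβ h, isNegASq_negASq hαβ hs hβ h,
      dense_rangeInverse_domain _ _ (isSymmetric_negGreenSq hβ h),
      isSelfAdjoint_rangeInverse _ _ (isSymmetric_negGreenSq hβ h), inner_negASq_lt_zero hβ h⟩,
    strictMono_besselZero hν, range_besselZero hν, exists_hilbertBasis_Phi hα2 hαβ hs,
    fun k hk => ?_⟩
  obtain ⟨k, rfl⟩ := Nat.exists_eq_add_of_le' hk
  refine ⟨Phi_mem_domASq hα2 hαβ hs k, fun x hx => ?_⟩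
  -- The eigenvalue of `𝒜` is `q = κ² j²`, so that of the square is `q ^ 2`.
  rw [(isBesselPair_Phi hα2 hαβ hs k).opASq_eq hαβ hx]
  ring
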